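/- Manifolds are finite-dimensional, Hausdorff, second countable and smooth. A filtered bundle of degree $k$ is a smooth fibre bundle $\pi\colon\mathcal F\to M$ with typical fibre $\mathbb R^N$ and an atlas of smooth local trivialisations ("adapted" ones), whose fibre coordinates $X^i$ carry weights $w_i\in\{1,\dots,k\}$ (the maximal weight $k$ need not occur), such that in every change of adapted trivialisation each new fibre coordinate of weight $w$ is a polynomial of weighted degree $\le w$ in the old fibre coordinates, with coefficients smooth functions on the base. A morphism is a smooth bundle map which in adapted coordinates expresses each target fibre coordinate of weight $u$ as a polynomial of weighted degree $\le u$ in the source fibre coordinates, with coefficients smooth functions on the base. This gives the category $\mathrm{FilB}[k]$. A filtered-linear bundle of degree $k$ is a filtered bundle $E$ of degree $k$ with a smooth action $h\colon\mathbb R\times E\to E$ of the multiplicative monoid of the reals such that every $h_t$ is a morphism of filtered bundles and $h$ is regular: if $\frac{d}{dt}\big|_{t=0}h_t(p)=0$, then $p=h_0(p)$. Morphisms are the morphisms of filtered bundles which commute with the actions. This gives the category $\mathrm{FilLB}[k]$. Let $\mathcal F\to M$ be a filtered bundle of degree $k\ge1$, and let $\mathsf V\mathcal F=\ker \mathsf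 T\pi\subset \mathsf T\mathcal F$ be its vertical bundle, with coordinates $(x^a,X^i,\delta X^i)$ induced by adapted coordinates $(x^a,X^i)$ of $\mathcal F$. Give $x^a$ the weight $0$, $X^i$ the weight $w_i$ and $\delta X^i$ the shifted weight $w_i-1$. A linearisation of $\mathcal F$ is a filtered-linear bundle $L$ of degree $k-1$, over a base $B$, together with a map $q_{\mathcal F}\colon \mathsf V\mathcal F\to L$ that forgets exactly the coordinates of top weight $k$, that is: * $B$ is itself a smooth bundle $b\colon B\to M$, and $q_{\mathcal F}$ covers the identity of $M$; * every adapted trivialisation of $\mathcal F$ over $U\subset M$ induces a smooth trivialisation of $B$ over $U$, with fibre coordinates $\delta X^i$ $(w_i=1)$, and an adapted trivialisation of $L$ over $b^{-1}(U)$, with fibre coordinates $X^i$ $(w_i\le k-1)$ of weight $w_i$ and $\delta X^i$ $(w_i>1)$ of weight $w_i-1$; here $X^i$ and $\delta X^i$ evaluated at $q_{\mathcal F}(v)$ are those of $v\in \mathsf V\mathcal F$; * $q_{\mathcal F}(t\,v)=h_t(q_{\mathcal F}(v))$ for all $t\in\mathbb R$ and $v\in \mathsf V\mathcal F$. **Theorem.**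 Let $k\ge 1$. There are a functor $$\mathrm{Linr}\colon \mathrm{FilB}[k]\longrightarrow \mathrm{FilLB}[k-1]$$ and maps $q_{\mathcal F}\colon \mathsf V\mathcal F\to \mathrm{Linr}(\mathcal F)$, one for each object $\mathcal F$ of $\mathrm{FilB}[k]$, such that $(\mathrm{Linr}(\mathcal F),q_{\mathcal F})$ is a linearisation of $\mathcal F$, and such that for every morphism $\phi\colon\mathcal F\to\mathcal G$ the morphism $\mathrm{Linr}(\phi)$ is the unique morphism $\psi\colon\mathrm{Linr}(\mathcal F)\to\mathrm{Linr}(\mathcal G)$ in $\mathrm{FilLB}[k-1]$ with $\psi\circ q_{\mathcal F}=q_{\mathcal G}\circ \mathsf V\phi$, where $\mathsf V\phi$ is the restriction of the tangent map of $\phi$ to the vertical bundles. -/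

import Mathlib

open CategoryTheory
open scoped Manifold ContDiff

universe u

/-! ### Smooth manifolds -/

/-- A finite-dimensional, Hausdorff, second countable smooth manifold without boundary. -/
structure SmoothMfd : Type (u + 1) where
  /-- the underlying set -/
  carrier : Type u
  /-- the finite-dimensional real vector space on which the manifold is modelled -/
  Model : Type
  [instNormed : NormedAddCommGroup Model]
  [instSpace : NormedSpace ℝ Model]
  [instFinite : FiniteDimensional ℝ Model]
  [instTop : TopologicalSpace carrier]
  [instCharted : ChartedSpace Model carrier]
  [instSmooth : IsManifold 𝓘(ℝ, Model) ∞ carrier]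
  [instT2 : T2Space carrier]
  [instCountable : SecondCountableTopology carrier]

namespace SmoothMfd

instance : CoeSort SmoothMfd.{u} (Type u) := ⟨carrier⟩

attribute [instance] instNormed instSpace instFinite instTop instCharted instSmooth instT2
  instCountable

/-- Smooth maps between manifolds. -/
def Smooth {X Y : SmoothMfd.{u}} (f : X → Y) : Prop :=
  ContMDiff 𝓘(ℝ, X.Model) 𝓘(ℝ, Y.Model) ∞ f

/-- A local trivialization with typical fibre `ι → ℝ` which is a diffeomorphism from its domain
(a set of the form `π ⁻¹' U`, with `U` open) onto `U × (ι → ℝ)`. -/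
def IsSmoothTriv {X M : SmoothMfd.{u}} {ι : Type} [Fintype ι] {π : X → M}
    (e : Bundle.Trivialization (ι → ℝ) π) : Prop :=
  ContMDiffOn 𝓘(ℝ, X.Model) (𝓘(ℝ, M.Model).prod 𝓘(ℝ, ι → ℝ)) ∞ e e.source ∧
  ContMDiffOn (𝓘(ℝ, M.Model).prod 𝓘(ℝ, ι → ℝ)) 𝓘(ℝ, X.Model) ∞
    e.toOpenPartialHomeomorph.symm e.target

end SmoothMfd

/-! ### Weighted polynomials -/

/-- `f` is a polynomial function, of weighted degree at most `d` if the `i`-th coordinate has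
weight `w i`. -/
def IsFilteredPoly {ι : Type} (w : ι → ℕ) (d : ℕ) (f : (ι → ℝ) → ℝ) : Prop :=
  ∃ P : MvPolynomial ι ℝ, P.weightedTotalDegree w ≤ d ∧ ∀ X, f X = MvPolynomial.eval X P

namespace IsFilteredPoly

variable {ι κ : Type} {w : ι → ℕ} {w' : κ → ℕ}

theorem wdeg_le_iff {P : MvPolynomial ι ℝ} {d : ℕ} :
    P.weightedTotalDegree w ≤ d ↔ ∀ s ∈ P.support, Finsupp.weight w s ≤ d := by
  simp [MvPolynomial.weightedTotalDegree, Finset.sup_le_iff]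

theorem const {d : ℕ} (c : ℝ) : IsFilteredPoly w d (fun _ => c) := by
  classical
  refine ⟨MvPolynomial.C c, wdeg_le_iff.2 fun s hs => ?_, by simp⟩
  have : s = 0 := by
    by_contra h
    simp [MvPolynomial.coeff_C, Ne.symm h] at hs
  simp [this]

theorem coord (i : ι) : IsFilteredPoly w (w i) (fun X => X i) := by
  classical
  refine ⟨MvPolynomial.X i, wdeg_le_iff.2 fun s hs => ?_, by simp⟩
  have : s = Finsupp.single i 1 := by
    by_contra h
    simp [MvPolynomial.coeff_X, Ne.symm h] at hs
  simp [this, Finsupp.weight_single]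

theorem mono {d d' : ℕ} {f : (ι → ℝ) → ℝ} (hf : IsFilteredPoly w d f) (h : d ≤ d') :
    IsFilteredPoly w d' f :=
  let ⟨P, hP, hf⟩ := hf
  ⟨P, hP.trans h, hf⟩

theorem add {d : ℕ} {f g : (ι → ℝ) → ℝ} (hf : IsFilteredPoly w d f)
    (hg : IsFilteredPoly w d g) : IsFilteredPoly w d (fun X => f X + g X) := by
  classical
  obtain ⟨P, hP, hf⟩ := hf
  obtain ⟨Q, hQ, hg⟩ := hg
  rw [wdeg_le_iff] at hP hQ
  refine ⟨P + Q, wdeg_le_iff.2 fun s hs => ?_, fun X => by simp [hf, hg]⟩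
  rcases Finset.mem_union.1 (MvPolynomial.support_add hs) with h | h
  exacts [hP s h, hQ s h]

theorem mul {d d' : ℕ} {f g : (ι → ℝ) → ℝ} (hf : IsFilteredPoly w d f)
    (hg : IsFilteredPoly w d' g) : IsFilteredPoly w (d + d') (fun X => f X * g X) := by
  classical
  obtain ⟨P, hP, hf⟩ := hf
  obtain ⟨Q, hQ, hg⟩ := hg
  rw [wdeg_le_iff] at hP hQ
  refine ⟨P * Q, wdeg_le_iff.2 fun s hs => ?_, fun X => by simp [hf, hg]⟩
  obtain ⟨a, ha, b, hb, rfl⟩ := Finset.mem_add.1 (MvPolynomial.support_mul P Q hs)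
  rw [map_add]
  exact add_le_add (hP a ha) (hQ b hb)

theorem sum {α : Type*} {d : ℕ} (S : Finset α) (f : α → (ι → ℝ) → ℝ)
    (hf : ∀ a ∈ S, IsFilteredPoly w d (f a)) :
    IsFilteredPoly w d (fun X => ∑ a ∈ S, f a X) := by
  classical
  induction S using Finset.induction_on with
  | empty => simpa using const (w := w) (d := d) 0
  | insert a S ha ih =>
    simp only [Finset.sum_insert ha]
    exact (hf a (by simp)).add (ih fun b hb => hf b (by simp [hb]))

theorem pow {d : ℕ} {f : (ι → ℝ) → ℝ} (hf : IsFilteredPoly w d f) (n : ℕ) :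
    IsFilteredPoly w (n * d) (fun X => f X ^ n) := by
  induction n with
  | zero => simpa using const (w := w) (d := 0) 1
  | succ n ih => simpa [pow_succ, Nat.succ_mul] using ih.mul hf

theorem prod {α : Type*} (S : Finset α) (d : α → ℕ) (f : α → (ι → ℝ) → ℝ)
    (hf : ∀ a ∈ S, IsFilteredPoly w (d a) (f a)) :
    IsFilteredPoly w (∑ a ∈ S, d a) (fun X => ∏ a ∈ S, f a X) := by
  classical
  induction S using Finset.induction_on with
  | empty => simpa using const (w := w) (d := 0) 1
  | insert a S ha ih =>
    simp only [Finset.sum_insert ha, Finset.prod_insert ha]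
    exact (hf a (by simp)).mul (ih fun b hb => hf b (by simp [hb]))

/-- Substituting polynomials of weighted degree at most `w' j` for the coordinates of weight
`w' j` does not increase the weighted degree. -/
theorem comp {d : ℕ} {g : (κ → ℝ) → ℝ} (hg : IsFilteredPoly w' d g) {f : (ι → ℝ) → κ → ℝ}
    (hf : ∀ j, IsFilteredPoly w (w' j) (fun X => f X j)) :
    IsFilteredPoly w d (fun X => g (f X)) := by
  obtain ⟨Q, hQ, hg⟩ := hg
  rw [wdeg_le_iff] at hQ
  simp only [hg, MvPolynomial.eval_eq]
  refine sum _ _ fun s hs => ?_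
  have h := (const (w := w) (d := 0) (Q.coeff s)).mul
    (prod s.support (fun j => s j * w' j) (fun j X => f X j ^ s j) fun j _ => (hf j).pow _)
  refine h.mono ?_
  have h2 := hQ s hs
  rw [Finsupp.weight_apply, Finsupp.sum] at h2
  simpa using h2

end IsFilteredPoly

/-! ### Filtered bundles -/

/-- A filtered bundle of degree `k`: a smooth fibre bundle `proj : total → base` with an atlas of
adapted local trivializations `π ⁻¹' U ≃ U × (Ix → ℝ)`, the fibre coordinate with index `i` having
weight `weight i ∈ {1, …, k}`, such that in the changes of trivialization each new fibre coordinate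
of weight `w` is, on every fibre, a polynomial of weighted degree at most `w` in the old fibre
coordinates. The coefficients of these polynomials depend smoothly on the point of the base,
because the trivializations are smooth. -/
structure FilteredBundle (k : ℕ) : Type (u + 1) where
  total : SmoothMfd.{u}
  base : SmoothMfd.{u}
  proj : total → base
  proj_smooth : SmoothMfd.Smooth proj
  /-- the index set of the fibre coordinates -/
  Ix : Type
  [instFintype : Fintype Ix]
  weight : Ix → ℕ
  weight_pos : ∀ i, 1 ≤ weight i
  weight_le : ∀ i, weight i ≤ k
  /-- the adapted local trivializations -/
  atlas : Set (Bundle.Trivialization (Ix → ℝ) proj)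
  atlas_cover : ∀ x : base, ∃ e ∈ atlas, x ∈ e.baseSet
  atlas_smooth : ∀ e ∈ atlas, SmoothMfd.IsSmoothTriv e
  atlas_compatible : ∀ e ∈ atlas, ∀ e' ∈ atlas, ∀ x ∈ e.baseSet, x ∈ e'.baseSet → ∀ i,
    IsFilteredPoly weight (weight i)
      (fun X => (e' (e.toOpenPartialHomeomorph.symm (x, X))).2 i)

attribute [instance] FilteredBundle.instFintype

namespace FilteredBundle

variable {k : ℕ}

/-- A morphism of filtered bundles: a smooth bundle map which, on every fibre and in adapted
coordinates, expresses each fibre coordinate of weight `u` of the target as a polynomial of weighted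
degree at most `u` in the fibre coordinates of the source. -/
@[ext]
structure Hom (F G : FilteredBundle.{u} k) where
  toFun : F.total → G.total
  baseMap : F.base → G.base
  smooth : SmoothMfd.Smooth toFun
  base_smooth : SmoothMfd.Smooth baseMap
  proj_comm : ∀ p, G.proj (toFun p) = baseMap (F.proj p)
  filtered : ∀ e ∈ F.atlas, ∀ e' ∈ G.atlas, ∀ x ∈ e.baseSet, baseMap x ∈ e'.baseSet → ∀ j,
    IsFilteredPoly F.weight (G.weight j)
      (fun X => (e' (toFun (e.toOpenPartialHomeomorph.symm (x, X)))).2 j)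

/-- The identity morphism. -/
def Hom.id (F : FilteredBundle.{u} k) : Hom F F where
  toFun := fun p => p
  baseMap := fun x => x
  smooth := contMDiff_id
  base_smooth := contMDiff_id
  proj_comm _ := rfl
  filtered := F.atlas_compatible

/-- Composition of morphisms (as smooth maps). -/
def Hom.comp {F G H : FilteredBundle.{u} k} (f : Hom F G) (g : Hom G H) : Hom F H where
  toFun := fun p => g.toFun (f.toFun p)
  baseMap := fun x => g.baseMap (f.baseMap x)
  smooth := ContMDiff.comp g.smooth f.smooth
  base_smooth := ContMDiff.comp g.base_smooth f.base_smooth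
  proj_comm p := by rw [g.proj_comm, f.proj_comm]
  filtered e he e'' he'' x hx hx'' j := by
    obtain ⟨e', he', hx'⟩ := G.atlas_cover (f.baseMap x)
    have h := (g.filtered e' he' e'' he'' _ hx' hx'' j).comp (f.filtered e he e' he' x hx hx')
    convert h using 2 with X
    have hp : G.proj (f.toFun (e.toOpenPartialHomeomorph.symm (x, X))) = f.baseMap x := by
      rw [f.proj_comm, e.proj_symm_apply' hx]
    have hs : f.toFun (e.toOpenPartialHomeomorph.symm (x, X)) ∈ e'.source := by
      rw [e'.mem_source, hp]; exact hx'
    have := e'.symm_apply_mk_proj hs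
    rw [hp] at this
    exact (congrArg (fun y => (e'' (g.toFun y)).2 j) this).symm

/-- The category `FilB[k]` of filtered bundles of degree `k`. -/
instance : Category (FilteredBundle.{u} k) where
  Hom := Hom
  id := Hom.id
  comp := Hom.comp

end FilteredBundle

/-! ### Filtered-linear bundles -/

/-- A filtered-linear bundle of degree `k`: a filtered bundle of degree `k` with a regular smooth
action `dil` of the multiplicative monoid of the reals by morphisms of filtered bundles. -/
structure FilteredLinearBundle (k : ℕ) : Type (u + 1) where
  fil : FilteredBundle.{u} k
  dil : ℝ → fil.total → fil.total
  dil_smooth : ContMDiff (𝓘(ℝ, ℝ).prod 𝓘(ℝ, fil.total.Model)) 𝓘(ℝ, fil.total.Model) ∞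
    (fun z : ℝ × fil.total => dil z.1 z.2)
  dil_one : ∀ p, dil 1 p = p
  dil_mul : ∀ s t p, dil (s * t) p = dil s (dil t p)
  /-- if the curve `t ↦ dil t p` has velocity zero at `t = 0`, then `p = dil 0 p` -/
  dil_regular : ∀ p,
    mfderiv 𝓘(ℝ, ℝ) 𝓘(ℝ, fil.total.Model) (fun t : ℝ => dil t p) 0 = 0 → p = dil 0 p
  dil_filtered : ∀ t, ∃ φ : fil ⟶ fil, φ.toFun = dil t

namespace FilteredLinearBundle

variable {k : ℕ}

/-- A morphism of filtered-linear bundles: a morphism of filtered bundles which respects the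
linear structures. -/
@[ext]
structure Hom (L L' : FilteredLinearBundle.{u} k) where
  fil : L.fil ⟶ L'.fil
  map_dil : ∀ t p, fil.toFun (L.dil t p) = L'.dil t (fil.toFun p)

/-- The category `FilLB[k]` of filtered-linear bundles of degree `k`. -/
instance : Category (FilteredLinearBundle.{u} k) where
  Hom := Hom
  id L := ⟨𝟙 L.fil, fun _ _ => rfl⟩
  comp f g := ⟨f.fil ≫ g.fil, fun t p =>
    (congrArg g.fil.toFun (f.map_dil t p)).trans (g.map_dil t _)⟩

end FilteredLinearBundle

/-! ### The vertical bundle and the linearisation -/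

namespace FilteredBundle

variable {k : ℕ}

/-- The vertical bundle `V F`: the tangent vectors of the total space that are annihilated by the
differential of the projection. -/
def Vertical (F : FilteredBundle.{u} k) : Type u :=
  {v : TangentBundle 𝓘(ℝ, F.total.Model) F.total //
    mfderiv 𝓘(ℝ, F.total.Model) 𝓘(ℝ, F.base.Model) F.proj v.1 v.2 = 0}

namespace Vertical

variable {F G : FilteredBundle.{u} k}

/-- The point at which a vertical vector is attached. -/
def pt (v : F.Vertical) : F.total := v.1.1

/-- The vector bundle structure of `V F`: multiplication of vertical vectors by reals. -/
noncomputable instance : SMul ℝ F.Vertical where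
  smul t v := ⟨⟨v.1.1, t • v.1.2⟩, by rw [map_smul, v.2, smul_zero]⟩

/-- The fibre coordinate `X_i` in the trivialization `e` of the base point of `v`. -/
def X (e : Bundle.Trivialization (F.Ix → ℝ) F.proj) (v : F.Vertical) (i : F.Ix) : ℝ :=
  (e v.pt).2 i

/-- The coordinate `δX_i` of a vertical vector `v`, that is, the derivative along `v` of the
`i`-th fibre coordinate in the trivialization `e`. -/
noncomputable def δX (e : Bundle.Trivialization (F.Ix → ℝ) F.proj) (v : F.Vertical) (i : F.Ix) :
    ℝ :=
  mfderiv 𝓘(ℝ, F.total.Model) 𝓘(ℝ, ℝ) (fun p => (e p).2 i) v.1.1 v.1.2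

/-- The vertical tangent map `V φ : V F → V G`, the restriction of the tangent map. -/
noncomputable def map (φ : F ⟶ G) (v : F.Vertical) : G.Vertical :=
  ⟨tangentMap 𝓘(ℝ, F.total.Model) 𝓘(ℝ, G.total.Model) φ.toFun v.1, by
    have d1 : MDifferentiableAt 𝓘(ℝ, F.total.Model) 𝓘(ℝ, G.total.Model) φ.toFun v.1.1 :=
      φ.smooth.mdifferentiable (by simp) _
    have d2 : MDifferentiableAt 𝓘(ℝ, G.total.Model) 𝓘(ℝ, G.base.Model) G.proj
      (φ.toFun v.1.1) := G.proj_smooth.mdifferentiable (by simp) _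
    have d3 : MDifferentiableAt 𝓘(ℝ, F.total.Model) 𝓘(ℝ, F.base.Model) F.proj v.1.1 :=
      F.proj_smooth.mdifferentiable (by simp) _
    have d4 : MDifferentiableAt 𝓘(ℝ, F.base.Model) 𝓘(ℝ, G.base.Model) φ.baseMap
      (F.proj v.1.1) := φ.base_smooth.mdifferentiable (by simp) _
    have h : G.proj ∘ φ.toFun = φ.baseMap ∘ F.proj := funext φ.proj_comm
    have h1 := mfderiv_comp v.1.1 d2 d1
    have h2 := mfderiv_comp v.1.1 d4 d3
    have h3 := DFunLike.congr_fun h1 v.1.2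
    rw [h] at h3
    refine h3.symm.trans ((DFunLike.congr_fun h2 v.1.2).trans ?_)
    exact (congrArg (mfderiv 𝓘(ℝ, F.base.Model) 𝓘(ℝ, G.base.Model) φ.baseMap
      (F.proj v.1.1)) v.2).trans (ContinuousLinearMap.map_zero _)⟩

end Vertical

/-- `L`, together with the map `q : V F → L`, is the linearisation of the filtered bundle `F` of
degree `k + 1`.

The vertical bundle `V F` has coordinates `x`, `X_i`, `δX_i`. Its filtered weights, shifted by the
linear weight, are `0` for `x`, `weight i` for `X_i`, and `weight i - 1` for `δX_i`. The map `q`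
forgets exactly the coordinates of shifted weight `k + 1`, i.e. the `X_i` with `weight i = k + 1`:

* the coordinates of shifted weight zero, `x` and the `δX_i` with `weight i = 1`, form the base of
  `L`, which is therefore itself a bundle over `F.base`, with projection `b`;
* the `X_i` with `weight i ≤ k` and the `δX_i` with `weight i > 1`, with their shifted weights, are
  adapted fibre coordinates of `L`;
* the linear structure of `L` is induced by that of `V F`. -/
structure IsLinearisation (F : FilteredBundle.{u} (k + 1)) (L : FilteredLinearBundle.{u} k)
    (q : F.Vertical → L.fil.total) : Prop where
  map_smul : ∀ (t : ℝ) (v : F.Vertical), q (t • v) = L.dil t (q v)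
  coordinates : ∃ (b : L.fil.base → F.base)
    (σ : {i : F.Ix // F.weight i ≤ k} ⊕ {i : F.Ix // 1 < F.weight i} ≃ L.fil.Ix),
    SmoothMfd.Smooth b ∧
    (∀ v, b (L.fil.proj (q v)) = F.proj v.pt) ∧
    (∀ i, L.fil.weight (σ (.inl i)) = F.weight i) ∧
    (∀ i, L.fil.weight (σ (.inr i)) = F.weight i - 1) ∧
    ∀ e ∈ F.atlas,
      ∃ c : Bundle.Trivialization ({i : F.Ix // F.weight i = 1} → ℝ) b,
        SmoothMfd.IsSmoothTriv c ∧ c.baseSet = e.baseSet ∧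
      ∃ e' ∈ L.fil.atlas, e'.baseSet = b ⁻¹' e.baseSet ∧
      ∀ v : F.Vertical, F.proj v.pt ∈ e.baseSet →
        (∀ i, (c (L.fil.proj (q v))).2 i = v.δX e i) ∧
        (∀ i, (e' (q v)).2 (σ (.inl i)) = v.X e i) ∧
        (∀ i, (e' (q v)).2 (σ (.inr i)) = v.δX e i)

end FilteredBundle

/-! In adapted coordinates a morphism is `X'_j = f_j(x, X)` on fibres, with `f_j` of weighted degree
at most `w'_j`, and its vertical lift is `δX'_j = ∑ ∂f_j/∂X_i δX_i`. Differentiation in `X_i` lowers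
the degree by `w_i`, so `∂f_j/∂X_i` has degree at most `w'_j - w_i`, and it vanishes when `w_i >
w'_j`. As all weights are at least 1, three facts follow. (a) The `δX'_j` of weight `w'_j = 1`
depend only on `x` and on the `δX_i` with `w_i = 1` (`baseCoord_fderiv`). (b) Neither the `X'_j`
with `w'_j ≤ k` nor any `δX'_j` involves an `X_i` of weight `k + 1`, because `w'_j - w_i ≤ k`
(`fibreCoord_fderiv`). (c) With `δX_i` shifted to weight `w_i - 1`, the degree of `δX'_j` is at most
`(w'_j - w_i) + (w_i - 1) = w'_j - 1` (`Linearisation.isFilteredPoly`).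

Hence forgetting the `X_i` of top weight is compatible with morphisms, and with changes of
trivialisation, which are the representatives of the identity morphism. The linearisation is a
quotient of the vertical bundle in two stages: keeping `x` and the `δX_i` of weight one gives the
base, and keeping also the other retained coordinates gives the total space over that base. Both
stages are instances of `LocalCoords`, which glues a fibre bundle from coordinate functions on a
set.

The vertical tangent map and the multiplication by reals descend because their effect on retained
coordinates depends only on retained coordinates. Since the quotient map is surjective, the functor
laws, the equivariance and the uniqueness reduce to statements about vertical vectors. -/

open Set

/-! ### Gluing a smooth fibre bundle from local coordinate functions -/

/-- A set over a manifold with local coordinate functions in a vector space `V`, whose changes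
are smooth. The points which cannot be distinguished by the coordinate functions are the points
of a manifold which is a fibre bundle with typical fibre `V`. -/
structure LocalCoords (M : SmoothMfd.{u}) (S : Type u) (V : Type) [NormedAddCommGroup V]
    [NormedSpace ℝ V] where
  pr : S → M
  J : Type u
  dom : J → Set M
  isOpen_dom : ∀ j, IsOpen (dom j)
  cover : ∀ x, ∃ j, x ∈ dom j
  coord : J → S → V
  exists_coord : ∀ j, ∀ x ∈ dom j, ∀ v, ∃ s, pr s = x ∧ coord j s = v
  change : J → J → M → V → V
  change_coord : ∀ i j s, pr s ∈ dom i → pr s ∈ dom j → change i j (pr s) (coord i s) = coord j s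
  change_smooth : ∀ i j, ContMDiffOn (𝓘(ℝ, M.Model).prod 𝓘(ℝ, V)) 𝓘(ℝ, V) ∞
    (fun z : M × V => change i j z.1 z.2) ((dom i ∩ dom j) ×ˢ univ)

namespace LocalCoords

variable {M : SmoothMfd.{u}} {S : Type u} {V : Type} [NormedAddCommGroup V]
    [NormedSpace ℝ V] (C : LocalCoords M S V)

/-- The fibre bundle core defined by the changes of coordinates. -/
noncomputable def core : FiberBundleCore C.J M V where
  baseSet := C.dom
  isOpen_baseSet := C.isOpen_dom
  indexAt x := (C.cover x).choose
  mem_baseSet_at x := (C.cover x).choose_spec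
  coordChange := C.change
  coordChange_self i x hx v := by
    obtain ⟨s, rfl, rfl⟩ := C.exists_coord i x hx v
    exact C.change_coord i i s hx hx
  continuousOn_coordChange i j := (C.change_smooth i j).continuousOn
  coordChange_comp i j k x hx v := by
    -- Every coordinate value is attained by some `s : S`, and on such values the cocycle identity
    -- just compares the coordinates of `s`.
    obtain ⟨s, rfl, rfl⟩ := C.exists_coord i x hx.1.1 v
    rw [C.change_coord i j s hx.1.1 hx.1.2, C.change_coord j k s hx.1.2 hx.2,
      C.change_coord i k s hx.1.1 hx.2]

/-- The chart obtained from a local trivialization and a chart of the base. -/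
noncomputable def chart (i : C.J) (c : OpenPartialHomeomorph M M.Model) :
    OpenPartialHomeomorph C.core.TotalSpace (M.Model × V) :=
  (C.core.localTriv i).toOpenPartialHomeomorph.trans (c.prod (OpenPartialHomeomorph.refl V))

theorem mem_chart_source (i : C.J) (c : OpenPartialHomeomorph M M.Model) (p : C.core.TotalSpace) :
    p ∈ (C.chart i c).source ↔ p.proj ∈ C.dom i ∧ p.proj ∈ c.source := by
  simp only [chart, mfld_simps]
  rfl

theorem mem_chart_target (i : C.J) (c : OpenPartialHomeomorph M M.Model) (z : M.Model × V) :
    z ∈ (C.chart i c).target ↔ z.1 ∈ c.target ∧ c.symm z.1 ∈ C.dom i := by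
  simp only [chart, mfld_simps]
  rfl

theorem chart_apply (i : C.J) (c : OpenPartialHomeomorph M M.Model) (p : C.core.TotalSpace) :
    C.chart i c p = (c p.proj, (C.core.localTriv i p).2) := rfl

theorem chart_symm_apply (i : C.J) (c : OpenPartialHomeomorph M M.Model) (z : M.Model × V) :
    (C.chart i c).symm z
      = (C.core.localTriv i).toOpenPartialHomeomorph.symm (c.symm z.1, z.2) := rfl

noncomputable instance : ChartedSpace (M.Model × V) C.core.TotalSpace where
  atlas := {f | ∃ i, ∃ c ∈ atlas M.Model M, f = C.chart i c}
  chartAt p := C.chart (C.core.indexAt p.proj) (chartAt M.Model p.proj)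
  mem_chart_source _ := (C.mem_chart_source _ _ _).2
    ⟨C.core.mem_baseSet_at _, ChartedSpace.mem_chart_source _⟩
  chart_mem_atlas _ := ⟨_, _, chart_mem_atlas _ _, rfl⟩

/-- Charts take values in the normed space `M.Model × V`, while trivialisations are smooth for the
product of two models. This map and `contMDiffOn_base` pass between the two. -/
theorem contMDiffOn_base_symm {c : OpenPartialHomeomorph M M.Model} (hc : c ∈ atlas M.Model M) :
    ContMDiffOn 𝓘(ℝ, M.Model × V) (𝓘(ℝ, M.Model).prod 𝓘(ℝ, V)) ∞
      (fun z : M.Model × V => (c.symm z.1, z.2)) (c.target ×ˢ univ) := by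
  have h := contMDiffOn_symm_of_mem_maximalAtlas (n := ∞) (I := 𝓘(ℝ, M.Model))
    (IsManifold.subset_maximalAtlas hc)
  refine ContMDiffOn.prodMk ?_ contDiff_snd.contMDiff.contMDiffOn
  exact h.comp contDiff_fst.contMDiff.contMDiffOn fun z hz => hz.1

theorem contMDiffOn_base {c : OpenPartialHomeomorph M M.Model} (hc : c ∈ atlas M.Model M) :
    ContMDiffOn (𝓘(ℝ, M.Model).prod 𝓘(ℝ, V)) 𝓘(ℝ, M.Model × V) ∞
      (fun z : M × V => (c z.1, z.2)) (c.source ×ˢ univ) := by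
  have h := contMDiffOn_of_mem_maximalAtlas (n := ∞) (I := 𝓘(ℝ, M.Model))
    (IsManifold.subset_maximalAtlas hc)
  refine ContMDiffOn.prodMk_space ?_ contMDiff_snd.contMDiffOn
  exact h.comp contMDiff_fst.contMDiffOn fun z hz => hz.1

/-- A transition map factors as an inverse base chart, the map `(x, v) ↦ (x, change i j x v)` and a
base chart, each of them smooth. -/
instance : IsManifold 𝓘(ℝ, M.Model × V) ∞ C.core.TotalSpace := by
  apply isManifold_of_contDiffOn
  rintro _ _ ⟨i, c, hc, rfl⟩ ⟨j, c', hc', rfl⟩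
  rw [← contMDiffOn_iff_contDiffOn]
  have h1 := contMDiffOn_base_symm (V := V) hc
  have h2 := contMDiffOn_base (V := V) hc'
  have h3 : ContMDiffOn (𝓘(ℝ, M.Model).prod 𝓘(ℝ, V)) (𝓘(ℝ, M.Model).prod 𝓘(ℝ, V)) ∞
    (fun z : M × V => (z.1, C.change i j z.1 z.2)) ((C.dom i ∩ C.dom j) ×ˢ univ) :=
    ContMDiffOn.prodMk contMDiff_fst.contMDiffOn (C.change_smooth i j)
  have key : ∀ z, z ∈ ((C.chart i c).symm.trans (C.chart j c')).source →
      z.1 ∈ c.target ∧ c.symm z.1 ∈ C.dom i ∧ c.symm z.1 ∈ C.dom j ∧ c.symm z.1 ∈ c'.source := by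
    intro z hz
    rw [OpenPartialHomeomorph.trans_source, mem_inter_iff, OpenPartialHomeomorph.symm_source,
      mem_chart_target, mem_preimage, mem_chart_source] at hz
    exact ⟨hz.1.1, hz.1.2, hz.2⟩
  have hs : (𝓘(ℝ, M.Model × V)).symm ⁻¹' ((C.chart i c).symm.trans (C.chart j c')).source
      ∩ range 𝓘(ℝ, M.Model × V) = ((C.chart i c).symm.trans (C.chart j c')).source := by
    simp
  rw [hs]
  refine ((h2.comp (h3.comp (h1.mono fun z hz => ?_) ?_) ?_)).congr ?_
  · exact ⟨(key z hz).1, trivial⟩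
  · exact fun z hz => ⟨⟨(key z hz).2.1, (key z hz).2.2.1⟩, trivial⟩
  · exact fun z hz => ⟨(key z hz).2.2.2, trivial⟩
  · intro z hz
    have := key z hz
    simp only [Function.comp_apply, OpenPartialHomeomorph.coe_trans, modelWithCornersSelf_coe,
      modelWithCornersSelf_coe_symm, id]
    rw [C.chart_apply, C.chart_symm_apply, FiberBundleCore.localTriv_symm_apply,
      FiberBundleCore.localTriv_apply]
    refine Prod.ext rfl ?_
    -- The inverse trivialisation records a point in the preferred coordinate `indexAt`; the cocycle
    -- identity eliminates this detour.
    exact C.core.coordChange_comp i _ j _ ⟨⟨this.2.1, C.core.mem_baseSet_at _⟩, this.2.2.1⟩ _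

theorem contMDiffOn_localTriv (i : C.J) :
    ContMDiffOn 𝓘(ℝ, M.Model × V) (𝓘(ℝ, M.Model).prod 𝓘(ℝ, V)) ∞
      (C.core.localTriv i) (C.core.localTriv i).source := by
  intro p hp
  have hp' : p.proj ∈ C.dom i := (C.core.mem_localTriv_source i p).1 hp
  have h1 := contMDiffOn_base_symm (V := V) (chart_mem_atlas M.Model p.proj)
  have h2 := contMDiffOn_of_mem_maximalAtlas (n := ∞) (I := 𝓘(ℝ, M.Model × V))
    (IsManifold.subset_maximalAtlas
      (show C.chart i (chartAt M.Model p.proj) ∈ atlas (M.Model × V) C.core.TotalSpace from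
      ⟨i, _, chart_mem_atlas _ _, rfl⟩))
  have hmem : p ∈ (C.chart i (chartAt M.Model p.proj)).source :=
    (C.mem_chart_source _ _ _).2 ⟨hp', ChartedSpace.mem_chart_source _⟩
  have h3 := h1.comp h2 (fun z hz => ⟨by
    have := (C.chart i (chartAt M.Model p.proj)).map_source hz
    exact ((C.mem_chart_target _ _ _).1 this).1, trivial⟩)
  refine (ContMDiffAt.congr_of_eventuallyEq
    (h3.contMDiffAt ((C.chart i _).open_source.mem_nhds hmem)) ?_).contMDiffWithinAt
  filter_upwards [(C.chart i _).open_source.mem_nhds hmem] with z hz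
  have := ((C.mem_chart_source _ _ _).1 hz).2
  exact Prod.ext ((chartAt M.Model p.proj).left_inv this).symm rfl

theorem contMDiffOn_localTriv_symm (i : C.J) :
    ContMDiffOn (𝓘(ℝ, M.Model).prod 𝓘(ℝ, V)) 𝓘(ℝ, M.Model × V) ∞
      (C.core.localTriv i).toOpenPartialHomeomorph.symm (C.core.localTriv i).target := by
  intro p hp
  have hp' : p.1 ∈ C.dom i := (C.core.mem_localTriv_target i p).1 hp
  have h1 := contMDiffOn_base (V := V) (chart_mem_atlas M.Model p.1)
  have h2 := contMDiffOn_symm_of_mem_maximalAtlas (n := ∞) (I := 𝓘(ℝ, M.Model × V))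
    (IsManifold.subset_maximalAtlas
      (show C.chart i (chartAt M.Model p.1) ∈ atlas (M.Model × V) C.core.TotalSpace from
      ⟨i, _, chart_mem_atlas _ _, rfl⟩))
  have hn : (C.dom i ∩ (chartAt M.Model p.1).source) ×ˢ (univ : Set V) ∈ nhds p :=
    (((C.isOpen_dom i).inter (chartAt M.Model p.1).open_source).prod isOpen_univ).mem_nhds
      ⟨⟨hp', ChartedSpace.mem_chart_source _⟩, trivial⟩
  have h1' := h1.mono (t := (C.dom i ∩ (chartAt M.Model p.1).source) ×ˢ (univ : Set V))
    fun z hz => ⟨hz.1.2, trivial⟩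
  have h3 := h2.comp h1' (fun z hz => by
      refine (C.mem_chart_target _ _ _).2 ⟨(chartAt M.Model p.1).map_source hz.1.2, ?_⟩
      rw [(chartAt M.Model p.1).left_inv hz.1.2]
      exact hz.1.1)
  refine (ContMDiffAt.congr_of_eventuallyEq (h3.contMDiffAt hn) ?_).contMDiffWithinAt
  filter_upwards [hn] with z hz
  rw [Function.comp_apply, C.chart_symm_apply, (chartAt M.Model p.1).left_inv hz.1.2]

/-- Points over the same base point are separated inside one trivialisation, the others by preimages
of open sets of the base. -/
instance : T2Space C.core.TotalSpace where
  t2 p p' hne := by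
    by_cases h : p.proj = p'.proj
    · let e := C.core.localTriv (C.core.indexAt p.proj)
      have hp : p ∈ e.source := (C.core.mem_localTriv_source _ _).2 (C.core.mem_baseSet_at _)
      have hp' : p' ∈ e.source := (C.core.mem_localTriv_source _ _).2
        (h ▸ C.core.mem_baseSet_at _)
      obtain ⟨u, v, hu, hv, hpu, hpv, huv⟩ := t2_separation (e.injOn.ne hp hp' hne)
      exact ⟨e.source ∩ e ⁻¹' u, e.source ∩ e ⁻¹' v,
        e.toOpenPartialHomeomorph.isOpen_inter_preimage hu,
        e.toOpenPartialHomeomorph.isOpen_inter_preimage hv, ⟨hp, hpu⟩, ⟨hp', hpv⟩,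
        (huv.preimage e).mono inter_subset_right inter_subset_right⟩
    · obtain ⟨u, v, hu, hv, hpu, hpv, huv⟩ := t2_separation h
      exact ⟨_, _, hu.preimage C.core.continuous_proj, hv.preimage C.core.continuous_proj,
        hpu, hpv, huv.preimage _⟩

/-- By second countability of the base, countably many of the sets `dom j` cover it. Over each one
the total space is homeomorphic to an open subset of `M × V`, and `V` is second countable because it
is proper. -/
instance [FiniteDimensional ℝ V] : SecondCountableTopology C.core.TotalSpace := by
  obtain ⟨t, ht, htU⟩ := TopologicalSpace.isOpen_iUnion_countable C.dom C.isOpen_dom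
  have := ht.to_subtype
  have := FiniteDimensional.proper ℝ V
  have hs (i : t) : SecondCountableTopology (C.core.localTriv i.1).source :=
    (C.core.localTriv i.1).toOpenPartialHomeomorph.secondCountableTopology_source
  refine TopologicalSpace.secondCountableTopology_of_countable_cover
    (U := fun i : t => (C.core.localTriv i.1).source)
    (fun i => (C.core.localTriv i.1).open_source) (eq_univ_of_forall fun p => ?_)
  obtain ⟨j, hj⟩ := C.cover p.proj
  have : p.proj ∈ ⋃ i ∈ t, C.dom i := htU ▸ mem_iUnion.2 ⟨j, hj⟩
  obtain ⟨i, hi, hp⟩ := mem_iUnion₂.1 this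
  exact mem_iUnion.2 ⟨⟨i, hi⟩, (C.core.mem_localTriv_source _ _).2 hp⟩

end LocalCoords

/-! ### The quotient map onto the glued manifold -/

namespace LocalCoords

variable {M : SmoothMfd.{u}} {S : Type u} {κ : Type} [Fintype κ] (C : LocalCoords M S (κ → ℝ))

/-- The manifold whose points are the points of `S`, up to being distinguished by the local
coordinates. -/
noncomputable def mfd : SmoothMfd.{u} where
  carrier := C.core.TotalSpace
  Model := M.Model × (κ → ℝ)

/-- The bundle projection. -/
noncomputable def proj : C.mfd → M := C.core.proj

/-- The local trivialization defined by a local coordinate. -/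
noncomputable def triv (j : C.J) : Bundle.Trivialization (κ → ℝ) C.proj := C.core.localTriv j

/-- The quotient map. -/
noncomputable def quot (s : S) : C.mfd :=
  (C.core.localTriv (C.core.indexAt (C.pr s))).toOpenPartialHomeomorph.symm
    (C.pr s, C.coord (C.core.indexAt (C.pr s)) s)

theorem triv_smooth (j : C.J) : SmoothMfd.IsSmoothTriv (C.triv j) :=
  ⟨C.contMDiffOn_localTriv j, C.contMDiffOn_localTriv_symm j⟩

theorem proj_quot (s : S) : C.proj (C.quot s) = C.pr s := rfl

theorem triv_quot {j : C.J} {s : S} (h : C.pr s ∈ C.dom j) :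
    C.triv j (C.quot s) = (C.pr s, C.coord j s) := by
  have h0 := C.core.mem_baseSet_at (C.pr s)
  refine Prod.ext rfl ?_
  -- The inner change goes from the preferred coordinate to itself, the outer one from there to `j`.
  change C.change _ j (C.pr s) (C.change _ _ (C.pr s) _) = _
  rw [C.change_coord _ _ s h0 h0]
  exact C.change_coord _ _ s h0 h

theorem quot_surjective : Function.Surjective C.quot := by
  intro p
  obtain ⟨j, hj⟩ := C.cover (C.proj p)
  obtain ⟨s, hs, hc⟩ := C.exists_coord j _ hj (C.triv j p).2
  refine ⟨s, ?_⟩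
  refine (C.triv j).injOn ((C.triv j).mem_source.2 ?_) ((C.triv j).mem_source.2 hj) ?_
  · rw [C.proj_quot, hs]; exact hj
  · refine (C.triv_quot (hs ▸ hj)).trans ?_
    rw [hs, hc]
    exact Prod.ext ((C.triv j).coe_fst' hj).symm rfl

theorem quot_eq {j : C.J} {s s' : S} (h : C.pr s ∈ C.dom j) (hp : C.pr s' = C.pr s)
    (hc : C.coord j s' = C.coord j s) : C.quot s' = C.quot s := by
  refine (C.triv j).injOn ((C.triv j).mem_source.2 ?_) ((C.triv j).mem_source.2 h) ?_
  · rw [C.proj_quot, hp]; exact h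
  · refine (C.triv_quot (hp ▸ h)).trans (Eq.trans ?_ (C.triv_quot h).symm)
    rw [hp, hc]

theorem triv_symm {j : C.J} {s : S} (h : C.pr s ∈ C.dom j) :
    (C.triv j).toOpenPartialHomeomorph.symm (C.pr s, C.coord j s) = C.quot s := by
  rw [← C.triv_quot h]
  exact (C.triv j).symm_apply_apply ((C.triv j).mem_source.2 h)

end LocalCoords

/-! ### Smoothness in trivialisations and derivatives with parameters -/

namespace SmoothMfd

variable {X M : SmoothMfd.{u}} {ι : Type} [Fintype ι] {π : X → M}
  {e : Bundle.Trivialization (ι → ℝ) π}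

theorem IsSmoothTriv.contMDiffOn_proj (he : IsSmoothTriv e) :
    ContMDiffOn 𝓘(ℝ, X.Model) 𝓘(ℝ, M.Model) ∞ π e.source :=
  (contMDiff_fst.comp_contMDiffOn he.1).congr fun _ hp => (e.coe_fst hp).symm

theorem IsSmoothTriv.contMDiffOn_snd (he : IsSmoothTriv e) :
    ContMDiffOn 𝓘(ℝ, X.Model) 𝓘(ℝ, ι → ℝ) ∞ (fun p => (e p).2) e.source :=
  contMDiff_snd.comp_contMDiffOn he.1

/-- A map to a bundle is smooth if its two components in a trivialization are smooth. -/
theorem IsSmoothTriv.contMDiffOn_of_comp (he : IsSmoothTriv e) {E H N : Type*}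
    [NormedAddCommGroup E] [NormedSpace ℝ E] [TopologicalSpace H] {I : ModelWithCorners ℝ E H}
    [TopologicalSpace N] [ChartedSpace H N] {g : N → X} {s : Set N}
    (hs : ∀ n ∈ s, π (g n) ∈ e.baseSet)
    (h1 : ContMDiffOn I 𝓘(ℝ, M.Model) ∞ (fun n => π (g n)) s)
    (h2 : ContMDiffOn I 𝓘(ℝ, ι → ℝ) ∞ (fun n => (e (g n)).2) s) :
    ContMDiffOn I 𝓘(ℝ, X.Model) ∞ g s := by
  refine (he.2.comp (h1.prodMk h2) fun n hn => e.mem_target.2 (hs n hn)).congr fun n hn => ?_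
  exact (e.symm_apply_mk_proj (e.mem_source.2 (hs n hn))).symm

end SmoothMfd

theorem LocalCoords.proj_smooth {M : SmoothMfd.{u}} {S : Type u} {κ : Type} [Fintype κ]
    (C : LocalCoords M S (κ → ℝ)) : SmoothMfd.Smooth C.proj := by
  intro p
  obtain ⟨j, hj⟩ := C.cover (C.proj p)
  exact (C.triv_smooth j).contMDiffOn_proj.contMDiffAt
    ((C.triv j).open_source.mem_nhds ((C.triv j).mem_source.2 hj))

section Manifold

variable {E H N : Type*} [NormedAddCommGroup E] [NormedSpace ℝ E] [TopologicalSpace H]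
  {I : ModelWithCorners ℝ E H} [TopologicalSpace N] [ChartedSpace H N]

theorem tangentMap_eq_self_of_eventuallyEq {f : N → N} {p : TangentBundle I N}
    (h : f =ᶠ[nhds p.1] id) : tangentMap I I f p = p := by
  refine Bundle.TotalSpace.ext h.eq_of_nhds (heq_of_eq ?_)
  have h1 : mfderiv I I f p.1 = mfderiv I I (id : N → N) p.1 := h.mfderiv_eq
  refine (congrArg (fun A : E →L[ℝ] E => A p.2) h1).trans ?_
  rw [mfderiv_id]
  rfl

/-- The derivative in the second variable of a smooth function of two variables is smooth. -/
theorem ContMDiffOn.fderiv_snd [IsManifold I 1 N] {E' H' M V W : Type*}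
    [NormedAddCommGroup E'] [NormedSpace ℝ E'] [TopologicalSpace H'] {I' : ModelWithCorners ℝ E' H'} [TopologicalSpace M] [ChartedSpace H' M]
    [NormedAddCommGroup V] [NormedSpace ℝ V] [NormedAddCommGroup W] [NormedSpace ℝ W]
    {f : M → V → W} {U : Set M} (hU : IsOpen U)
    (hf : ContMDiffOn (I'.prod 𝓘(ℝ, V)) 𝓘(ℝ, W) ∞ (fun z : M × V => f z.1 z.2) (U ×ˢ univ))
    {a : N → M} {X δ : N → V} {s : Set N} (hs : IsOpen s) (hsU : ∀ n ∈ s, a n ∈ U)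
    (ha : ContMDiffOn I I' ∞ a s) (hX : ContMDiffOn I 𝓘(ℝ, V) ∞ X s)
    (hδ : ContMDiffOn I 𝓘(ℝ, V) ∞ δ s) :
    ContMDiffOn I 𝓘(ℝ, W) ∞ (fun n => fderiv ℝ (f (a n)) (X n) (δ n)) s := by
  intro n hn
  have hn' := hs.mem_nhds hn
  have h1 : ContMDiffAt (I'.prod 𝓘(ℝ, V)) 𝓘(ℝ, W) ∞ (fun z : M × V => f z.1 z.2) (a n, X n) :=
    hf.contMDiffAt ((hU.prod isOpen_univ).mem_nhds ⟨hsU n hn, trivial⟩)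
  have h2 : ContMDiffAt (I.prod 𝓘(ℝ, V)) (I'.prod 𝓘(ℝ, V)) ∞
      (fun z : N × V => (a z.1, z.2)) (n, X n) :=
    ((ha.contMDiffAt hn').comp (n, X n) contMDiffAt_fst).prodMk contMDiffAt_snd
  have h3 := h1.comp (n, X n) h2
  -- This gives smoothness of the derivative read in tangent coordinates, which are trivial between
  -- vector spaces (`h5`).
  have h4 := ContMDiffAt.mfderiv (m := ∞) (fun n => f (a n)) X h3 (hX.contMDiffAt hn') (by simp)
  have h5 : inTangentCoordinates 𝓘(ℝ, V) 𝓘(ℝ, W) X (fun x => f (a x) (X x))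
      (fun x => mfderiv 𝓘(ℝ, V) 𝓘(ℝ, W) (f (a x)) (X x)) n
      = fun x => fderiv ℝ (f (a x)) (X x) :=
    (inTangentCoordinates_model_space X (fun x => f (a x) (X x))
      (fun x => (mfderiv 𝓘(ℝ, V) 𝓘(ℝ, W) (f (a x)) (X x) : V →L[ℝ] W)) n).trans
      (funext fun x => mfderiv_eq_fderiv)
  rw [h5] at h4
  exact (h4.clm_apply (hδ.contMDiffAt hn')).contMDiffWithinAt

end Manifold

/-! ### Vertical vectors in adapted coordinates -/

namespace FilteredBundle

variable {k : ℕ} {F G H : FilteredBundle.{u} k}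

/-- The local representative of a morphism, in adapted trivializations. -/
noncomputable def rep (φ : F ⟶ G) (e : Bundle.Trivialization (F.Ix → ℝ) F.proj)
    (e' : Bundle.Trivialization (G.Ix → ℝ) G.proj) (x : F.base) (X : F.Ix → ℝ) : G.Ix → ℝ :=
  (e' (φ.toFun (e.toOpenPartialHomeomorph.symm (x, X)))).2

variable {e : Bundle.Trivialization (F.Ix → ℝ) F.proj}
  {e' : Bundle.Trivialization (G.Ix → ℝ) G.proj}

theorem contMDiff_fibre (he : e ∈ F.atlas) {x : F.base} (hx : x ∈ e.baseSet) :
    ContMDiff 𝓘(ℝ, F.Ix → ℝ) 𝓘(ℝ, F.total.Model) ∞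
      (fun X => e.toOpenPartialHomeomorph.symm (x, X)) := by
  rw [← contMDiffOn_univ]
  exact (F.atlas_smooth e he).2.comp
    (contMDiff_const.prodMk contMDiff_id).contMDiffOn fun X _ => e.mem_target.2 hx

theorem contMDiffOn_rep (φ : F ⟶ G) (he : e ∈ F.atlas) (he' : e' ∈ G.atlas) :
    ContMDiffOn (𝓘(ℝ, F.base.Model).prod 𝓘(ℝ, F.Ix → ℝ)) 𝓘(ℝ, G.Ix → ℝ) ∞
      (fun z : F.base × (F.Ix → ℝ) => rep φ e e' z.1 z.2)
      ((e.baseSet ∩ φ.baseMap ⁻¹' e'.baseSet) ×ˢ univ) := by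
  have h1 := (F.atlas_smooth e he).2.mono
    (t := (e.baseSet ∩ φ.baseMap ⁻¹' e'.baseSet) ×ˢ univ)
    fun z hz => e.mem_target.2 hz.1.1
  have h2 := ContMDiff.comp_contMDiffOn φ.smooth h1
  refine (G.atlas_smooth e' he').contMDiffOn_snd.comp h2 fun z hz => ?_
  rw [mem_preimage, e'.mem_source, φ.proj_comm,
    e.proj_symm_apply (e.mem_target.2 hz.1.1)]
  exact hz.1.2

namespace Vertical

theorem smul_val (t : ℝ) (v : F.Vertical) : (t • v).1 = ⟨v.1.1, t • v.1.2⟩ := rfl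

theorem proj_map (φ : F ⟶ G) (v : F.Vertical) :
    G.proj (map φ v).pt = φ.baseMap (F.proj v.pt) := φ.proj_comm v.pt

theorem smul_X (t : ℝ) (v : F.Vertical) : (t • v).X e = v.X e := rfl

theorem smul_δX (t : ℝ) (v : F.Vertical) : (t • v).δX e = t • v.δX e := by
  ext i
  exact (mfderiv 𝓘(ℝ, F.total.Model) 𝓘(ℝ, ℝ) (fun p => (e p).2 i) v.1.1).map_smul t v.1.2

theorem map_id (v : F.Vertical) : map (𝟙 F) v = v :=
  Subtype.ext (tangentMap_eq_self_of_eventuallyEq (Filter.EventuallyEq.refl _ _))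

theorem map_comp (φ : F ⟶ G) (ψ : G ⟶ H) (v : F.Vertical) :
    map (φ ≫ ψ) v = map ψ (map φ v) :=
  Subtype.ext (tangentMap_comp_at v.1 (ψ.smooth.mdifferentiable (by simp) _)
    (φ.smooth.mdifferentiable (by simp) _))

theorem map_smul (φ : F ⟶ G) (t : ℝ) (v : F.Vertical) : map φ (t • v) = t • map φ v := by
  refine Subtype.ext ?_
  rw [smul_val]
  refine Bundle.TotalSpace.ext rfl (heq_of_eq ?_)
  exact (mfderiv 𝓘(ℝ, F.total.Model) 𝓘(ℝ, G.total.Model) φ.toFun v.1.1).map_smul t v.1.2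

/-- The chain rule turns the manifold derivative in `δX` into a derivative on a vector space. It
serves with `g` the inclusion of a fibre, and with `g` that inclusion followed by a morphism. -/
theorem δX_eq_fderiv (he' : e' ∈ G.atlas) {V : Type*} [NormedAddCommGroup V] [NormedSpace ℝ V]
    {g : V → G.total} (hg : ContMDiff 𝓘(ℝ, V) 𝓘(ℝ, G.total.Model) ∞ g) {w : G.Vertical} {X δ : V}
    (hw : w.1 = tangentMap 𝓘(ℝ, V) 𝓘(ℝ, G.total.Model) g ⟨X, δ⟩)
    (hx : G.proj w.pt ∈ e'.baseSet) :
    w.δX e' = fderiv ℝ (fun Y => (e' (g Y)).2) X δ := by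
  have hpt : w.pt = g X := congrArg (fun z => z.1) hw
  have hs : g X ∈ e'.source := by rw [e'.mem_source, ← hpt]; exact hx
  have h1 : ContMDiffAt 𝓘(ℝ, G.total.Model) 𝓘(ℝ, G.Ix → ℝ) ∞ (fun p => (e' p).2) (g X) :=
    (G.atlas_smooth e' he').contMDiffOn_snd.contMDiffAt (e'.open_source.mem_nhds hs)
  have h2 : DifferentiableAt ℝ (fun Y => (e' (g Y)).2) X :=
    (contMDiffAt_iff_contDiffAt.1 (h1.comp X hg.contMDiffAt)).differentiableAt (by simp)
  ext i
  have h3 : ContMDiffAt 𝓘(ℝ, G.total.Model) 𝓘(ℝ, ℝ) ∞ (fun p => (e' p).2 i) (g X) :=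
    contMDiffAt_pi_space.1 h1 i
  have h4 := tangentMap_comp_at (⟨X, δ⟩ : TangentBundle 𝓘(ℝ, V) V)
    (h3.mdifferentiableAt (by simp)) (hg.mdifferentiable (by simp) X)
  rw [← hw] at h4
  have h5 : w.δX e' i = fderiv ℝ (fun Y => (e' (g Y)).2 i) X δ := by
    rw [← mfderiv_eq_fderiv]
    exact (congrArg (fun z : TangentBundle 𝓘(ℝ, ℝ) ℝ => (z.2 : ℝ)) h4).symm
  rw [h5, fderiv_apply h2]
  rfl

/-- A vertical vector is tangent to the fibre. -/
theorem val_eq_tangentMap (he : e ∈ F.atlas) (v : F.Vertical) (hv : F.proj v.pt ∈ e.baseSet) :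
    v.1 = tangentMap 𝓘(ℝ, F.Ix → ℝ) 𝓘(ℝ, F.total.Model)
      (fun X => e.toOpenPartialHomeomorph.symm (F.proj v.pt, X)) ⟨v.X e, v.δX e⟩ := by
  have hs : v.pt ∈ e.source := e.mem_source.2 hv
  have he1 : ContMDiffAt 𝓘(ℝ, F.total.Model) (𝓘(ℝ, F.base.Model).prod 𝓘(ℝ, F.Ix → ℝ)) ∞ e v.pt :=
    (F.atlas_smooth e he).1.contMDiffAt (e.open_source.mem_nhds hs)
  have he2 : ContMDiffAt (𝓘(ℝ, F.base.Model).prod 𝓘(ℝ, F.Ix → ℝ)) 𝓘(ℝ, F.total.Model) ∞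
      e.toOpenPartialHomeomorph.symm (e v.pt) :=
    (F.atlas_smooth e he).2.contMDiffAt
      (e.open_target.mem_nhds (e.toOpenPartialHomeomorph.map_source hs))
  have hep : e v.pt = (F.proj v.pt, v.X e) := Prod.ext (e.coe_fst' hv) rfl
  have h0 : tangentMap 𝓘(ℝ, F.total.Model) 𝓘(ℝ, F.total.Model)
      (e.toOpenPartialHomeomorph.symm ∘ e) v.1 = v.1 := by
    refine tangentMap_eq_self_of_eventuallyEq ?_
    filter_upwards [e.open_source.mem_nhds hs] with p hp
    exact e.toOpenPartialHomeomorph.left_inv hp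
  have h1 := tangentMap_comp_at v.1 (he2.mdifferentiableAt (by simp))
    (he1.mdifferentiableAt (by simp))
  have he3 : MDifferentiableAt 𝓘(ℝ, F.total.Model) 𝓘(ℝ, F.Ix → ℝ) (fun p => (e p).2) v.pt :=
    ((F.atlas_smooth e he).contMDiffOn_snd.contMDiffAt
      (e.open_source.mem_nhds hs)).mdifferentiableAt (by simp)
  have hπ : MDifferentiableAt 𝓘(ℝ, F.total.Model) 𝓘(ℝ, F.base.Model) F.proj v.pt :=
    F.proj_smooth.mdifferentiable (by simp) _
  have hev : e =ᶠ[nhds v.pt] fun p => (F.proj p, (e p).2) := by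
    filter_upwards [e.open_source.mem_nhds hs] with p hp
    exact Prod.ext (e.coe_fst hp) rfl
  have hδ : mfderiv 𝓘(ℝ, F.total.Model) 𝓘(ℝ, F.Ix → ℝ) (fun p => (e p).2) v.pt v.1.2
      = v.δX e := by
    refine funext fun i => ?_
    have h := mfderiv_comp v.pt
      ((ContinuousLinearMap.proj (R := ℝ) (φ := fun _ : F.Ix => ℝ) i).mdifferentiableAt
        (x := (e v.pt).2)) he3
    rw [ContinuousLinearMap.mfderiv_eq] at h
    exact (congrArg (fun A : F.total.Model →L[ℝ] ℝ => A v.1.2) h).symm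
  -- Verticality enters here: the base component of the image of `v` under the differential of `e`
  -- is zero, so this image is tangent to the slice over `F.proj v.pt`.
  have h2 : tangentMap 𝓘(ℝ, F.total.Model) (𝓘(ℝ, F.base.Model).prod 𝓘(ℝ, F.Ix → ℝ)) e v.1
      = tangentMap 𝓘(ℝ, F.Ix → ℝ) (𝓘(ℝ, F.base.Model).prod 𝓘(ℝ, F.Ix → ℝ))
        (fun X => (F.proj v.pt, X)) ⟨v.X e, v.δX e⟩ := by
    refine Bundle.TotalSpace.ext hep (heq_of_eq ?_)
    have h3 : mfderiv 𝓘(ℝ, F.total.Model) (𝓘(ℝ, F.base.Model).prod 𝓘(ℝ, F.Ix → ℝ)) e v.pt =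
      (mfderiv 𝓘(ℝ, F.total.Model) 𝓘(ℝ, F.base.Model) F.proj v.pt).prod
        (mfderiv 𝓘(ℝ, F.total.Model) 𝓘(ℝ, F.Ix → ℝ) (fun p => (e p).2) v.pt) :=
      hev.mfderiv_eq.trans (hπ.mfderiv_prod he3)
    have h4 : mfderiv 𝓘(ℝ, F.Ix → ℝ) (𝓘(ℝ, F.base.Model).prod 𝓘(ℝ, F.Ix → ℝ))
      (fun X : F.Ix → ℝ => (F.proj v.pt, X)) (v.X e) = ContinuousLinearMap.inr ℝ _ _ :=
      mfderiv_prod_right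
    refine (congrArg (fun A : F.total.Model →L[ℝ] F.base.Model × (F.Ix → ℝ) => A v.1.2) h3).trans
      (Eq.trans ?_ (congrArg (fun A : (F.Ix → ℝ) →L[ℝ] F.base.Model × (F.Ix → ℝ) => A (v.δX e))
        h4).symm)
    exact Prod.ext v.2 hδ
  have h5 : MDifferentiableAt (𝓘(ℝ, F.base.Model).prod 𝓘(ℝ, F.Ix → ℝ)) 𝓘(ℝ, F.total.Model)
      e.toOpenPartialHomeomorph.symm (F.proj v.pt, v.X e) :=
    hep ▸ he2.mdifferentiableAt (by simp)
  have h6 : MDifferentiableAt 𝓘(ℝ, F.Ix → ℝ) (𝓘(ℝ, F.base.Model).prod 𝓘(ℝ, F.Ix → ℝ))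
      (fun X : F.Ix → ℝ => (F.proj v.pt, X)) (v.X e) :=
    mdifferentiableAt_const.prodMk mdifferentiableAt_id
  rw [← h0, h1, h2]
  exact (tangentMap_comp_at (⟨v.X e, v.δX e⟩ : TangentBundle 𝓘(ℝ, F.Ix → ℝ) (F.Ix → ℝ))
    h5 h6).symm

/-- The fibre coordinates of vertical vectors are arbitrary. -/
theorem exists_coord (he : e ∈ F.atlas) {x : F.base} (hx : x ∈ e.baseSet) (X δ : F.Ix → ℝ) :
    ∃ v : F.Vertical, F.proj v.pt = x ∧ v.X e = X ∧ v.δX e = δ := by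
  have hg := contMDiff_fibre he hx
  have hc : F.proj ∘ (fun X => e.toOpenPartialHomeomorph.symm (x, X)) = fun _ => x :=
    funext fun X => e.proj_symm_apply (e.mem_target.2 hx)
  have h := mfderiv_comp X (F.proj_smooth.mdifferentiable (by simp) _)
    (hg.mdifferentiable (by simp) X)
  rw [hc, mfderiv_const] at h
  have hr (Y : F.Ix → ℝ) : (e (e.toOpenPartialHomeomorph.symm (x, Y))).2 = Y := by
    have := e.apply_symm_apply (x := (x, Y)) (e.mem_target.2 hx)
    exact congrArg Prod.snd this
  -- The inclusion of a fibre pushes `(X, δ)` forward to a vertical vector, since its composite with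
  -- `F.proj` is constant.
  let v : F.Vertical := ⟨tangentMap 𝓘(ℝ, F.Ix → ℝ) 𝓘(ℝ, F.total.Model)
    (fun X => e.toOpenPartialHomeomorph.symm (x, X)) ⟨X, δ⟩,
    (congrArg (fun A : (F.Ix → ℝ) →L[ℝ] F.base.Model => A δ) h).symm⟩
  have hv : F.proj v.pt = x := congrFun hc X
  refine ⟨v, hv, hr X, ?_⟩
  rw [δX_eq_fderiv he hg (w := v) rfl (hv ▸ hx)]
  simp only [hr]
  exact congrArg (fun A : (F.Ix → ℝ) →L[ℝ] (F.Ix → ℝ) => A δ) fderiv_id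

theorem map_X (φ : F ⟶ G) (v : F.Vertical) (hv : F.proj v.pt ∈ e.baseSet) :
    (map φ v).X e' = rep φ e e' (F.proj v.pt) (v.X e) := by
  have : e.toOpenPartialHomeomorph.symm (F.proj v.pt, v.X e) = v.pt :=
    e.symm_apply_mk_proj (e.mem_source.2 hv)
  ext i
  rw [rep, this]
  rfl

/-- A vertical vector is tangent to a fibre (`val_eq_tangentMap`), so only the derivative of the
representative along the fibre contributes. -/
theorem map_δX (φ : F ⟶ G) (he : e ∈ F.atlas) (he' : e' ∈ G.atlas) (v : F.Vertical)
    (hv : F.proj v.pt ∈ e.baseSet) (hv' : φ.baseMap (F.proj v.pt) ∈ e'.baseSet) :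
    (map φ v).δX e' = fderiv ℝ (rep φ e e' (F.proj v.pt)) (v.X e) (v.δX e) := by
  have hg := contMDiff_fibre he hv
  refine δX_eq_fderiv he' (ContMDiff.comp φ.smooth hg) ?_ ((proj_map φ v).symm ▸ hv')
  have h := tangentMap_comp_at (⟨v.X e, v.δX e⟩ : TangentBundle 𝓘(ℝ, F.Ix → ℝ) (F.Ix → ℝ))
    (φ.smooth.mdifferentiable (by simp) _) (hg.mdifferentiable (by simp) _)
  rw [← val_eq_tangentMap he v hv] at h
  exact h.symm

end Vertical

end FilteredBundle

/-! ### Differentiation and weighted degree -/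

theorem MvPolynomial.hasFDerivAt_eval {ι : Type*} [Fintype ι] (P : MvPolynomial ι ℝ) (X : ι → ℝ) :
    HasFDerivAt (fun X => MvPolynomial.eval X P)
      (∑ i, MvPolynomial.eval X (MvPolynomial.pderiv i P) •
        ContinuousLinearMap.proj (R := ℝ) (φ := fun _ : ι => ℝ) i) X := by
  classical
  induction P using MvPolynomial.induction_on with
  | C a => simpa using hasFDerivAt_const a X
  | add p q hp hq =>
    simp only [map_add, add_smul, Finset.sum_add_distrib]
    exact hp.add hq
  | mul_X p j hp =>
    have h := hp.mul (ContinuousLinearMap.proj (R := ℝ) (φ := fun _ : ι => ℝ) j).hasFDerivAt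
    simp only [map_mul, MvPolynomial.eval_X]
    refine h.congr_fderiv ?_
    ext δ
    simp [Derivation.leibniz, MvPolynomial.pderiv_X, Pi.single_apply, add_mul,
      Finset.sum_add_distrib, Finset.mul_sum, mul_assoc, apply_ite (MvPolynomial.eval X), ite_mul]

namespace IsFilteredPoly

variable {ι : Type} {w : ι → ℕ} {d : ℕ} {f : (ι → ℝ) → ℝ}

/-- A polynomial of weighted degree at most `d` only depends on the variables of weight at
most `d`. -/
theorem eq_of_eqOn (hf : IsFilteredPoly w d f) {X X' : ι → ℝ} (h : ∀ i, w i ≤ d → X i = X' i) :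
    f X = f X' := by
  obtain ⟨P, hP, hf⟩ := hf
  rw [wdeg_le_iff] at hP
  simp only [hf, MvPolynomial.eval_eq]
  refine Finset.sum_congr rfl fun s hs => congrArg _ (Finset.prod_congr rfl fun i hi => ?_)
  -- A variable occurring in a monomial has weight at most that of the monomial.
  rw [h i ((Finsupp.le_weight_of_ne_zero' w (Finsupp.mem_support_iff.1 hi)).trans (hP s hs))]

/-- The partial derivative with respect to a variable of weight `w i` lowers the weighted degree by
`w i`. -/
theorem exists_hasFDerivAt [Fintype ι] (hf : IsFilteredPoly w d f) :
    ∃ g : ι → (ι → ℝ) → ℝ,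
      (∀ X, HasFDerivAt f (∑ i, g i X •
        ContinuousLinearMap.proj (R := ℝ) (φ := fun _ : ι => ℝ) i) X) ∧
      (∀ i, w i ≤ d → IsFilteredPoly w (d - w i) (g i)) ∧ ∀ i, d < w i → ∀ X, g i X = 0 := by
  classical
  obtain ⟨P, hP, hf⟩ := hf
  rw [wdeg_le_iff] at hP
  -- Stated additively because natural subtraction truncates: if `w i ≤ d` this is the degree bound,
  -- and if `d < w i` it leaves no monomial at all.
  have key : ∀ i, ∀ s ∈ (MvPolynomial.pderiv i P).support, Finsupp.weight w s + w i ≤ d := by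
    intro i s hs
    have h : s + Finsupp.single i 1 ∈ P.support := by
      rw [MvPolynomial.mem_support_iff, MvPolynomial.coeff_pderiv] at hs
      exact MvPolynomial.mem_support_iff.2 (left_ne_zero_of_mul hs)
    simpa [Finsupp.weight_single] using hP _ h
  refine ⟨fun i X => MvPolynomial.eval X (MvPolynomial.pderiv i P), fun X => ?_, fun i hi =>
    ⟨_, wdeg_le_iff.2 fun s hs => Nat.le_sub_of_add_le (key i s hs), fun _ => rfl⟩,
    fun i hi X => ?_⟩
  · rw [show f = fun X => MvPolynomial.eval X P from funext hf]
    exact MvPolynomial.hasFDerivAt_eval P X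
  · have : MvPolynomial.pderiv i P = 0 := by
      rw [← MvPolynomial.support_eq_empty, Finset.eq_empty_iff_forall_notMem]
      intro s hs
      have := key i s hs
      omega
    simp [this]

end IsFilteredPoly

/-! ### Coordinates of the linearisation -/

namespace Linearisation

variable {ι ι' : Type} {k : ℕ}

/-- The index set of the fibre coordinates of the linearisation. -/
abbrev Idx (k : ℕ) (w : ι → ℕ) : Type := {i // w i ≤ k} ⊕ {i // 1 < w i}

/-- The weights of the fibre coordinates of the linearisation. -/
def wt (k : ℕ) (w : ι → ℕ) : Idx k w → ℕ := Sum.elim (fun i => w i) fun i => w i - 1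

/-- The fibre coordinates of the linearisation. -/
def fibreCoord (k : ℕ) (w : ι → ℕ) (X δ : ι → ℝ) : Idx k w → ℝ :=
  Sum.elim (fun i => X i) fun i => δ i

/-- The coordinates of the base of the linearisation. -/
def baseCoord (w : ι → ℕ) (δ : ι → ℝ) (i : {i // w i = 1}) : ℝ := δ i

/-- Extension of the coordinates `X` by zero. -/
def extX (k : ℕ) (w : ι → ℕ) (Y : Idx k w → ℝ) (i : ι) : ℝ :=
  -- The value 0 at top weight is harmless by `fibreCoord_fderiv`.
  if h : w i ≤ k then Y (.inl ⟨i, h⟩) else 0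

/-- The coordinates `δX` from the coordinates of the base and of the fibres. -/
def extδ (k : ℕ) (w : ι → ℕ) (β : {i // w i = 1} → ℝ) (Y : Idx k w → ℝ) (i : ι) : ℝ :=
  -- The last 0 is reached only at weight zero, which positivity of the weights excludes.
  if h : 1 < w i then Y (.inr ⟨i, h⟩) else if h : w i = 1 then β ⟨i, h⟩ else 0

variable {w : ι → ℕ} {w' : ι' → ℕ}

theorem baseCoord_extδ (β : {i // w i = 1} → ℝ) (Y : Idx k w → ℝ) :
    baseCoord w (extδ k w β Y) = β := by
  funext i
  simp [baseCoord, extδ, i.2]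

theorem fibreCoord_ext (β : {i // w i = 1} → ℝ) (Y : Idx k w → ℝ) :
    fibreCoord k w (extX k w Y) (extδ k w β Y) = Y := by
  funext i
  rcases i with i | i
  · simp [fibreCoord, extX, i.2]
  · simp [fibreCoord, extδ, i.2]

theorem extX_fibreCoord (X δ : ι → ℝ) {i : ι} (hi : w i ≤ k) :
    extX k w (fibreCoord k w X δ) i = X i := by
  simp [fibreCoord, extX, hi]

theorem extδ_coord (hw : ∀ i, 1 ≤ w i) (X δ : ι → ℝ) :
    extδ k w (baseCoord w δ) (fibreCoord k w X δ) = δ := by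
  funext i
  rcases (hw i).lt_or_eq with h | h
  · simp [fibreCoord, extδ, h]
  · simp [baseCoord, extδ, ← h]

theorem contDiff_extX [Fintype ι] : ContDiff ℝ ∞ (extX k w) := by
  refine contDiff_pi.2 fun i => ?_
  by_cases h : w i ≤ k
  · simpa [extX, h] using contDiff_apply ℝ ℝ (Sum.inl ⟨i, h⟩ : Idx k w)
  · simpa [extX, h] using contDiff_const

theorem contDiff_extδ [Fintype ι] :
    ContDiff ℝ ∞ (fun z : ({i // w i = 1} → ℝ) × (Idx k w → ℝ) => extδ k w z.1 z.2) := by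
  refine contDiff_pi.2 fun i => ?_
  by_cases h : 1 < w i
  · simpa [extδ, h, Function.comp_def] using
      (contDiff_apply ℝ ℝ (Sum.inr ⟨i, h⟩ : Idx k w)).comp
        (contDiff_snd (E := {i // w i = 1} → ℝ))
  · by_cases h' : w i = 1
    · simpa [extδ, h', Function.comp_def] using
        (contDiff_apply ℝ ℝ (⟨i, h'⟩ : {i // w i = 1})).comp (contDiff_fst (F := Idx k w → ℝ))
    · simpa [extδ, h, h'] using contDiff_const

theorem contDiff_baseCoord [Fintype ι] : ContDiff ℝ ∞ (baseCoord w) :=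
  contDiff_pi.2 fun i => contDiff_apply ℝ ℝ i.1

theorem contDiff_fibreCoord [Fintype ι] :
    ContDiff ℝ ∞ (fun z : (ι → ℝ) × (ι → ℝ) => fibreCoord k w z.1 z.2) := by
  refine contDiff_pi.2 fun i => ?_
  rcases i with i | i
  · exact (contDiff_apply ℝ ℝ i.1).comp contDiff_fst
  · exact (contDiff_apply ℝ ℝ i.1).comp contDiff_snd

variable [Fintype ι] {f : (ι → ℝ) → ι' → ℝ}

theorem differentiableAt (hf : ∀ j, IsFilteredPoly w (w' j) fun X => f X j) (X : ι → ℝ) :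
    DifferentiableAt ℝ f X :=
  differentiableAt_pi.2 fun j => ((hf j).exists_hasFDerivAt.choose_spec.1 X).differentiableAt

theorem exists_fderiv (hf : ∀ j, IsFilteredPoly w (w' j) fun X => f X j) (j : ι') :
    ∃ g : ι → (ι → ℝ) → ℝ, (∀ X δ, fderiv ℝ f X δ j = ∑ i, g i X * δ i) ∧
      (∀ i, w i ≤ w' j → IsFilteredPoly w (w' j - w i) (g i)) ∧
      ∀ i, w' j < w i → ∀ X, g i X = 0 := by
  obtain ⟨g, h1, h2, h3⟩ := (hf j).exists_hasFDerivAt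
  refine ⟨g, fun X δ => ?_, h2, h3⟩
  have h := fderiv_apply (differentiableAt hf X) j
  rw [(h1 X).fderiv] at h
  have h' := congrArg (fun A : (ι → ℝ) →L[ℝ] ℝ => A δ) h
  simp only [sum_apply, smul_apply,
    ContinuousLinearMap.proj_apply, smul_eq_mul] at h'
  exact h'.symm

/-- The coordinates of weight one of the derivative of a filtered map only depend on the coordinates
of weight one of the vector. -/
theorem baseCoord_fderiv (hw : ∀ i, 1 ≤ w i) (hf : ∀ j, IsFilteredPoly w (w' j) fun X => f X j)
    {X X' δ δ' : ι → ℝ} (h : baseCoord w δ = baseCoord w δ') :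
    baseCoord w' (fderiv ℝ f X δ) = baseCoord w' (fderiv ℝ f X' δ') := by
  funext j
  obtain ⟨g, h1, h2, h3⟩ := exists_fderiv hf j.1
  simp only [baseCoord, h1]
  have hj := j.2
  refine Finset.sum_congr rfl fun i _ => ?_
  -- Here `w' j = 1`. The derivative in `X i` vanishes if `w i > 1`; if `w i = 1` it has degree 0,
  -- so it is constant, no variable having weight 0.
  rcases (hw i).lt_or_eq with hi | hi
  · rw [h3 i (by omega), h3 i (by omega), zero_mul, zero_mul]
  · have hd : δ i = δ' i := congrFun h ⟨i, hi.symm⟩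
    have hg := (h2 i (by omega)).eq_of_eqOn (X := X) (X' := X') fun l hl => by
      have := hw l
      omega
    rw [hd, hg]

/-- The coordinates of the linearisation of the image of a vector by the derivative of a filtered
map only depend on the coordinates of the linearisation of the vector. -/
theorem fibreCoord_fderiv (hw : ∀ i, 1 ≤ w i) (hw' : ∀ j, w' j ≤ k + 1)
    (hf : ∀ j, IsFilteredPoly w (w' j) fun X => f X j) {X X' δ : ι → ℝ}
    (h : ∀ i, w i ≤ k → X i = X' i) :
    fibreCoord k w' (f X) (fderiv ℝ f X δ) = fibreCoord k w' (f X') (fderiv ℝ f X' δ) := by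
  funext j
  rcases j with j | j
  · exact (hf j.1).eq_of_eqOn fun i hi => h i (hi.trans j.2)
  · obtain ⟨g, h1, h2, h3⟩ := exists_fderiv hf j.1
    simp only [fibreCoord, Sum.elim_inr, h1]
    refine Finset.sum_congr rfl fun i _ => congrArg (· * δ i) ?_
    rcases le_or_gt (w i) (w' j.1) with hi | hi
    · refine (h2 i hi).eq_of_eqOn fun l hl => h l ?_
      have := hw i
      have := hw' j.1
      omega
    · rw [h3 i hi, h3 i hi]

/-- The linearisation of a filtered map is filtered. -/
theorem isFilteredPoly (hw : ∀ i, 1 ≤ w i) (hf : ∀ j, IsFilteredPoly w (w' j) fun X => f X j)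
    (β : {i // w i = 1} → ℝ) (j : Idx k w') :
    IsFilteredPoly (wt k w) (wt k w' j) (fun Y =>
      fibreCoord k w' (f (extX k w Y)) (fderiv ℝ f (extX k w Y) (extδ k w β Y)) j) := by
  have hX : ∀ i, IsFilteredPoly (wt k w) (w i) (fun Y => extX k w Y i) := by
    intro i
    by_cases h : w i ≤ k
    · simpa [extX, h, wt] using IsFilteredPoly.coord (w := wt k w) (Sum.inl ⟨i, h⟩)
    · simpa [extX, h] using IsFilteredPoly.const 0
  have hδ : ∀ i, IsFilteredPoly (wt k w) (w i - 1) (fun Y => extδ k w β Y i) := by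
    intro i
    rcases (hw i).lt_or_eq with h | h
    · simpa [extδ, h, wt] using IsFilteredPoly.coord (w := wt k w) (Sum.inr ⟨i, h⟩)
    -- The `δX` of weight one are coordinates of the base, hence constants on a fibre of the
    -- linearisation.
    · simpa [extδ, ← h] using IsFilteredPoly.const (d := 0) _
  rcases j with j | j
  · exact (hf j.1).comp hX
  · obtain ⟨g, h1, h2, h3⟩ := exists_fderiv hf j.1
    simp only [fibreCoord, Sum.elim_inr, h1]
    refine IsFilteredPoly.sum _ _ fun i _ => ?_
    rcases le_or_gt (w i) (w' j.1) with hi | hi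
    · refine (((h2 i hi).comp hX).mul (hδ i)).mono ?_
      have := hw i
      simp only [wt, Sum.elim_inr]
      omega
    · simpa [h3 i hi] using IsFilteredPoly.const 0

end Linearisation

/-! ### Scaling in the coordinates of the linearisation -/

namespace Linearisation

variable {ι : Type} {k : ℕ} {w : ι → ℕ}

/-- The action of the reals on the fibre coordinates of the linearisation. -/
def scale (t : ℝ) (Y : Idx k w → ℝ) : Idx k w → ℝ :=
  Sum.elim (fun i => Y (.inl i)) fun i => t * Y (.inr i)

theorem fibreCoord_smul (t : ℝ) (X δ : ι → ℝ) :
    fibreCoord k w X (t • δ) = scale t (fibreCoord k w X δ) := by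
  funext i
  rcases i with i | i <;> rfl

theorem contDiff_scale [Fintype ι] :
    ContDiff ℝ ∞ (fun z : ℝ × (Idx k w → ℝ) => scale z.1 z.2) := by
  refine contDiff_pi.2 fun i => ?_
  rcases i with i | i
  · have h := (contDiff_apply ℝ ℝ (n := ∞) (Sum.inl i : Idx k w)).comp
      (contDiff_snd (E := ℝ) (F := Idx k w → ℝ))
    exact h
  · exact contDiff_fst.mul ((contDiff_apply ℝ ℝ (Sum.inr i : Idx k w)).comp contDiff_snd)

theorem isFilteredPoly_scale (t : ℝ) (j : Idx k w) :
    IsFilteredPoly (wt k w) (wt k w j) (fun Y => scale t Y j) := by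
  rcases j with j | j
  · exact IsFilteredPoly.coord (w := wt k w) (Sum.inl j)
  · exact ((IsFilteredPoly.const (d := 0) t).mul
      (IsFilteredPoly.coord (w := wt k w) (Sum.inr j))).mono (zero_add _).le

end Linearisation

open Linearisation

namespace FilteredBundle

variable {k : ℕ} {F G : FilteredBundle.{u} (k + 1)}

namespace Vertical

theorem one_smul (v : F.Vertical) : (1 : ℝ) • v = v :=
  Subtype.ext (Bundle.TotalSpace.ext rfl (heq_of_eq (_root_.one_smul ℝ v.1.2)))

theorem mul_smul (s t : ℝ) (v : F.Vertical) : (s * t) • v = s • t • v :=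
  Subtype.ext (Bundle.TotalSpace.ext rfl (heq_of_eq (SemigroupAction.mul_smul s t v.1.2)))

end Vertical

/-! ### Local representatives of the linearisation of a morphism -/

/-- The local representative of the base map of the linearisation of a morphism. -/
noncomputable def baseRep (φ : F ⟶ G) (e : Bundle.Trivialization (F.Ix → ℝ) F.proj)
    (e' : Bundle.Trivialization (G.Ix → ℝ) G.proj) (x : F.base)
    (β : {i // F.weight i = 1} → ℝ) : {i // G.weight i = 1} → ℝ :=
  -- The point 0 and the zero fibre coordinates are arbitrary choices, to which the weight-one
  -- components are insensitive (`baseCoord_fderiv`).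
  baseCoord G.weight (fderiv ℝ (rep φ e e' x) 0 (extδ k F.weight β 0))

/-- The local representative of the linearisation of a morphism. -/
noncomputable def fibreRep (φ : F ⟶ G) (e : Bundle.Trivialization (F.Ix → ℝ) F.proj)
    (e' : Bundle.Trivialization (G.Ix → ℝ) G.proj) (x : F.base)
    (β : {i // F.weight i = 1} → ℝ) (Y : Idx k F.weight → ℝ) : Idx k G.weight → ℝ :=
  fibreCoord k G.weight (rep φ e e' x (extX k F.weight Y))
    (fderiv ℝ (rep φ e e' x) (extX k F.weight Y) (extδ k F.weight β Y))

variable {e : Bundle.Trivialization (F.Ix → ℝ) F.proj}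
  {e' : Bundle.Trivialization (G.Ix → ℝ) G.proj}

theorem baseRep_coord (φ : F ⟶ G) (he : e ∈ F.atlas) (he' : e' ∈ G.atlas) (v : F.Vertical)
    (hv : F.proj v.pt ∈ e.baseSet) (hv' : φ.baseMap (F.proj v.pt) ∈ e'.baseSet) :
    baseRep φ e e' (F.proj v.pt) (baseCoord F.weight (v.δX e))
      = baseCoord G.weight ((Vertical.map φ v).δX e') := by
  rw [Vertical.map_δX φ he he' v hv hv', baseRep]
  exact baseCoord_fderiv F.weight_pos (φ.filtered e he e' he' _ hv hv') (baseCoord_extδ _ _)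

theorem fibreRep_coord (φ : F ⟶ G) (he : e ∈ F.atlas) (he' : e' ∈ G.atlas) (v : F.Vertical)
    (hv : F.proj v.pt ∈ e.baseSet) (hv' : φ.baseMap (F.proj v.pt) ∈ e'.baseSet) :
    fibreRep φ e e' (F.proj v.pt) (baseCoord F.weight (v.δX e))
        (fibreCoord k F.weight (v.X e) (v.δX e))
      = fibreCoord k G.weight ((Vertical.map φ v).X e') ((Vertical.map φ v).δX e') := by
  rw [Vertical.map_δX φ he he' v hv hv', Vertical.map_X φ v hv, fibreRep,
    extδ_coord F.weight_pos]
  exact fibreCoord_fderiv F.weight_pos G.weight_le (φ.filtered e he e' he' _ hv hv')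
    fun i hi => extX_fibreCoord _ _ hi

section Smooth

variable {E H N : Type*} [NormedAddCommGroup E] [NormedSpace ℝ E] [TopologicalSpace H]
  {I : ModelWithCorners ℝ E H} [TopologicalSpace N] [ChartedSpace H N] [IsManifold I 1 N]
  {a : N → F.base} {β : N → {i // F.weight i = 1} → ℝ} {Y : N → Idx k F.weight → ℝ} {s : Set N}

theorem contMDiffOn_baseRep (φ : F ⟶ G) (he : e ∈ F.atlas) (he' : e' ∈ G.atlas) (hs : IsOpen s)
    (hsU : ∀ n ∈ s, a n ∈ e.baseSet ∩ φ.baseMap ⁻¹' e'.baseSet)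
    (ha : ContMDiffOn I 𝓘(ℝ, F.base.Model) ∞ a s)
    (hβ : ContMDiffOn I 𝓘(ℝ, {i // F.weight i = 1} → ℝ) ∞ β s) :
    ContMDiffOn I 𝓘(ℝ, {i // G.weight i = 1} → ℝ) ∞ (fun n => baseRep φ e e' (a n) (β n)) s := by
  have hδ := contDiff_extδ (k := k) (w := F.weight).contMDiff.comp_contMDiffOn
    (hβ.prodMk_space (contMDiffOn_const (c := (0 : Idx k F.weight → ℝ))))
  exact contDiff_baseCoord.contMDiff.comp_contMDiffOn (ContMDiffOn.fderiv_snd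
    (e.open_baseSet.inter (e'.open_baseSet.preimage φ.base_smooth.continuous))
    (contMDiffOn_rep φ he he') hs hsU ha contMDiffOn_const hδ)

theorem contMDiffOn_fibreRep (φ : F ⟶ G) (he : e ∈ F.atlas) (he' : e' ∈ G.atlas) (hs : IsOpen s)
    (hsU : ∀ n ∈ s, a n ∈ e.baseSet ∩ φ.baseMap ⁻¹' e'.baseSet)
    (ha : ContMDiffOn I 𝓘(ℝ, F.base.Model) ∞ a s)
    (hβ : ContMDiffOn I 𝓘(ℝ, {i // F.weight i = 1} → ℝ) ∞ β s)
    (hY : ContMDiffOn I 𝓘(ℝ, Idx k F.weight → ℝ) ∞ Y s) :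
    ContMDiffOn I 𝓘(ℝ, Idx k G.weight → ℝ) ∞
      (fun n => fibreRep φ e e' (a n) (β n) (Y n)) s := by
  have hX := (contDiff_extX (k := k) (w := F.weight)).contMDiff.comp_contMDiffOn hY
  have hδ := contDiff_extδ (k := k) (w := F.weight).contMDiff.comp_contMDiffOn
    (hβ.prodMk_space hY)
  have h1 := ContMDiffOn.fderiv_snd
    (e.open_baseSet.inter (e'.open_baseSet.preimage φ.base_smooth.continuous))
    (contMDiffOn_rep φ he he') hs hsU ha hX hδ
  have h2 := (contMDiffOn_rep φ he he').comp (ha.prodMk hX) fun n hn => ⟨hsU n hn, trivial⟩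
  exact contDiff_fibreCoord.contMDiff.comp_contMDiffOn (h2.prodMk_space h1)

end Smooth

/-! ### The base and the total space of the linearisation -/

/-- The local coordinates of the base of the linearisation. -/
noncomputable def baseCoords (F : FilteredBundle.{u} (k + 1)) :
    LocalCoords F.base F.Vertical ({i // F.weight i = 1} → ℝ) where
  pr v := F.proj v.pt
  J := F.atlas
  dom e := e.1.baseSet
  isOpen_dom e := e.1.open_baseSet
  cover x := let ⟨e, he, hx⟩ := F.atlas_cover x; ⟨⟨e, he⟩, hx⟩
  coord e v := baseCoord F.weight (v.δX e.1)
  exists_coord e x hx β :=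
    let ⟨v, hv, _, hδ⟩ := Vertical.exists_coord e.2 hx 0 (extδ k F.weight β 0)
    ⟨v, hv, by rw [hδ, baseCoord_extδ]⟩
  -- Changes of coordinates are the representatives of the identity morphism, so the results on
  -- morphisms apply to them.
  change e e' := baseRep (𝟙 F) e.1 e'.1
  change_coord e e' v hv hv' := by
    rw [baseRep_coord (𝟙 F) e.2 e'.2 v hv hv', Vertical.map_id]
  change_smooth e e' := contMDiffOn_baseRep (𝟙 F) e.2 e'.2
    ((e.1.open_baseSet.inter e'.1.open_baseSet).prod isOpen_univ) (fun _ hz => hz.1)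
    contMDiffOn_fst contMDiffOn_snd

/-- The local coordinates of the total space of the linearisation. -/
noncomputable def fibreCoords (F : FilteredBundle.{u} (k + 1)) :
    LocalCoords F.baseCoords.mfd F.Vertical (Idx k F.weight → ℝ) where
  pr := F.baseCoords.quot
  J := F.atlas
  dom e := F.baseCoords.proj ⁻¹' e.1.baseSet
  isOpen_dom e := e.1.open_baseSet.preimage F.baseCoords.proj_smooth.continuous
  cover b := F.baseCoords.cover (F.baseCoords.proj b)
  coord e v := fibreCoord k F.weight (v.X e.1) (v.δX e.1)
  exists_coord e b hb Y := by
    obtain ⟨s, rfl⟩ := F.baseCoords.quot_surjective b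
    -- The lift takes its weight-one `δX` from `s`, so as to lie over the given point of the base,
    -- and all other retained coordinates from `Y`.
    obtain ⟨v, hv, hX, hδ⟩ := Vertical.exists_coord e.2 hb (extX k F.weight Y)
      (extδ k F.weight (baseCoord F.weight (s.δX e.1)) Y)
    refine ⟨v, F.baseCoords.quot_eq (j := e) hb hv ?_, ?_⟩
    · change baseCoord F.weight (v.δX e.1) = _
      rw [hδ, baseCoord_extδ]
      rfl
    · rw [hX, hδ, fibreCoord_ext]
  change e e' b Y := fibreRep (𝟙 F) e.1 e'.1 (F.baseCoords.proj b) (F.baseCoords.triv e b).2 Y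
  change_coord e e' v hv hv' := by
    rw [F.baseCoords.triv_quot (j := e) hv]
    have h := fibreRep_coord (𝟙 F) e.2 e'.2 v hv hv'
    rw [Vertical.map_id] at h
    exact h
  change_smooth e e' := by
    have hp := F.baseCoords.proj_smooth
    refine contMDiffOn_fibreRep (𝟙 F) e.2 e'.2 (IsOpen.prod ?_ isOpen_univ) (fun _ hz => hz.1)
      (ContMDiff.comp_contMDiffOn hp contMDiffOn_fst) ?_ contMDiffOn_snd
    · exact (e.1.open_baseSet.inter e'.1.open_baseSet).preimage hp.continuous
    · exact (F.baseCoords.triv_smooth e).contMDiffOn_snd.comp contMDiffOn_fst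
        fun z hz => (F.baseCoords.triv e).mem_source.2 hz.1.1

variable (F) in
/-- The projection from the vertical bundle to the linearisation. -/
noncomputable def linQuot : F.Vertical → F.fibreCoords.mfd := F.fibreCoords.quot

theorem linQuot_surjective : Function.Surjective F.linQuot := F.fibreCoords.quot_surjective

theorem proj_linQuot (v : F.Vertical) :
    F.fibreCoords.proj (F.linQuot v) = F.baseCoords.quot v := rfl

theorem triv_baseQuot (e : F.atlas) {v : F.Vertical} (hv : F.proj v.pt ∈ e.1.baseSet) :
    F.baseCoords.triv e (F.baseCoords.quot v) = (F.proj v.pt, baseCoord F.weight (v.δX e.1)) :=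
  F.baseCoords.triv_quot (j := e) hv

theorem triv_linQuot (e : F.atlas) {v : F.Vertical} (hv : F.proj v.pt ∈ e.1.baseSet) :
    F.fibreCoords.triv e (F.linQuot v)
      = (F.baseCoords.quot v, fibreCoord k F.weight (v.X e.1) (v.δX e.1)) :=
  F.fibreCoords.triv_quot (j := e) hv

theorem baseQuot_eq_iff {v v' : F.Vertical} (e : F.atlas) (hv : F.proj v.pt ∈ e.1.baseSet) :
    F.baseCoords.quot v' = F.baseCoords.quot v ↔ F.proj v'.pt = F.proj v.pt ∧
      baseCoord F.weight (v'.δX e.1) = baseCoord F.weight (v.δX e.1) := by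
  refine ⟨fun h => ?_, fun h => F.baseCoords.quot_eq (j := e) hv h.1 h.2⟩
  have hp : F.proj v'.pt = F.proj v.pt := congrArg F.baseCoords.proj h
  have h1 := congrArg (F.baseCoords.triv e) h
  rw [triv_baseQuot e hv, triv_baseQuot e (hp ▸ hv)] at h1
  exact Prod.ext_iff.1 h1

/-- Equality in the quotient can be tested in a single trivialisation; with `baseQuot_eq_iff` this
makes the induced maps well defined. -/
theorem linQuot_eq_iff {v v' : F.Vertical} (e : F.atlas) (hv : F.proj v.pt ∈ e.1.baseSet) :
    F.linQuot v' = F.linQuot v ↔ F.baseCoords.quot v' = F.baseCoords.quot v ∧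
      fibreCoord k F.weight (v'.X e.1) (v'.δX e.1)
        = fibreCoord k F.weight (v.X e.1) (v.δX e.1) := by
  refine ⟨fun h => ?_, fun h => F.fibreCoords.quot_eq (j := e) hv h.1 h.2⟩
  have hp : F.baseCoords.quot v' = F.baseCoords.quot v := congrArg F.fibreCoords.proj h
  have hp' : F.proj v'.pt = F.proj v.pt := congrArg F.baseCoords.proj hp
  have h1 := congrArg (F.fibreCoords.triv e) h
  rw [triv_linQuot e hv, triv_linQuot e (hp' ▸ hv)] at h1
  exact Prod.ext_iff.1 h1

variable (F) in
/-- The linearisation as a filtered bundle. -/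
noncomputable def linFil : FilteredBundle.{u} k where
  total := F.fibreCoords.mfd
  base := F.baseCoords.mfd
  proj := F.fibreCoords.proj
  proj_smooth := F.fibreCoords.proj_smooth
  Ix := Idx k F.weight
  weight := wt k F.weight
  weight_pos := by
    rintro (i | i)
    · exact F.weight_pos i
    · exact Nat.le_sub_of_add_le i.2
  weight_le := by
    rintro (i | i)
    · exact i.2
    · exact Nat.sub_le_of_le_add (F.weight_le i)
  atlas := range F.fibreCoords.triv
  atlas_cover b := let ⟨j, hj⟩ := F.fibreCoords.cover b; ⟨_, ⟨j, rfl⟩, hj⟩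
  atlas_smooth := by
    rintro _ ⟨j, rfl⟩
    exact F.fibreCoords.triv_smooth j
  atlas_compatible := by
    rintro _ ⟨e, rfl⟩ _ ⟨e', rfl⟩ b hb hb' i
    have h := isFilteredPoly (k := k) F.weight_pos
      (F.atlas_compatible e.1 e.2 e'.1 e'.2 (F.baseCoords.proj b) hb hb')
      (F.baseCoords.triv e b).2 i
    convert h using 2 with Y
    -- Once the point is lifted to a vertical vector, both sides are coordinates of that vector in
    -- `e'`.
    obtain ⟨v, rfl, rfl⟩ := F.fibreCoords.exists_coord e b hb Y
    rw [F.fibreCoords.triv_symm hb, F.fibreCoords.triv_quot hb']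
    exact congrFun (F.fibreCoords.change_coord e e' v hb hb').symm i

/-! ### The linearisation of a morphism -/

/-- The base map of the linearisation of a morphism. -/
noncomputable def linBaseMap (φ : F ⟶ G) (b : F.baseCoords.mfd) : G.baseCoords.mfd :=
  G.baseCoords.quot (Vertical.map φ (Function.surjInv F.baseCoords.quot_surjective b))

/-- The linearisation of a morphism, as a map. -/
noncomputable def linFun (φ : F ⟶ G) (p : F.fibreCoords.mfd) : G.fibreCoords.mfd :=
  G.linQuot (Vertical.map φ (Function.surjInv linQuot_surjective p))

/-- By `baseRep_coord` the retained coordinates of the image are functions of those of the vector,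
so the representative chosen in `linBaseMap` does not matter. -/
theorem baseQuot_map_congr (φ : F ⟶ G) {v v' : F.Vertical}
    (h : F.baseCoords.quot v' = F.baseCoords.quot v) :
    G.baseCoords.quot (Vertical.map φ v') = G.baseCoords.quot (Vertical.map φ v) := by
  obtain ⟨e, he, hv⟩ := F.atlas_cover (F.proj v.pt)
  obtain ⟨e', he', hv'⟩ := G.atlas_cover (φ.baseMap (F.proj v.pt))
  obtain ⟨h1, h2⟩ := (baseQuot_eq_iff ⟨e, he⟩ hv).1 h
  refine (baseQuot_eq_iff ⟨e', he'⟩ ((Vertical.proj_map φ v).symm ▸ hv')).2 ⟨?_, ?_⟩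
  · rw [Vertical.proj_map, Vertical.proj_map, h1]
  · rw [← baseRep_coord φ he he' v hv hv',
      ← baseRep_coord φ he he' v' (h1 ▸ hv) (h1 ▸ hv'), h1, h2]

theorem linQuot_map_congr (φ : F ⟶ G) {v v' : F.Vertical} (h : F.linQuot v' = F.linQuot v) :
    G.linQuot (Vertical.map φ v') = G.linQuot (Vertical.map φ v) := by
  obtain ⟨e, he, hv⟩ := F.atlas_cover (F.proj v.pt)
  obtain ⟨e', he', hv'⟩ := G.atlas_cover (φ.baseMap (F.proj v.pt))
  obtain ⟨h1, h2⟩ := (linQuot_eq_iff ⟨e, he⟩ hv).1 h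
  obtain ⟨h3, h4⟩ := (baseQuot_eq_iff ⟨e, he⟩ hv).1 h1
  refine (linQuot_eq_iff ⟨e', he'⟩ ((Vertical.proj_map φ v).symm ▸ hv')).2
    ⟨baseQuot_map_congr φ h1, ?_⟩
  rw [← fibreRep_coord φ he he' v hv hv',
    ← fibreRep_coord φ he he' v' (h3 ▸ hv) (h3 ▸ hv'), h3, h4, h2]

theorem linBaseMap_quot (φ : F ⟶ G) (v : F.Vertical) :
    linBaseMap φ (F.baseCoords.quot v) = G.baseCoords.quot (Vertical.map φ v) :=
  baseQuot_map_congr φ (Function.surjInv_eq _ _)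

theorem linFun_linQuot (φ : F ⟶ G) (v : F.Vertical) :
    linFun φ (F.linQuot v) = G.linQuot (Vertical.map φ v) :=
  linQuot_map_congr φ (Function.surjInv_eq _ _)

theorem proj_linBaseMap (φ : F ⟶ G) (b : F.baseCoords.mfd) :
    G.baseCoords.proj (linBaseMap φ b) = φ.baseMap (F.baseCoords.proj b) := by
  obtain ⟨v, rfl⟩ := F.baseCoords.quot_surjective b
  rw [linBaseMap_quot]
  exact Vertical.proj_map φ v

theorem proj_linFun (φ : F ⟶ G) (p : F.fibreCoords.mfd) :
    G.fibreCoords.proj (linFun φ p) = linBaseMap φ (F.fibreCoords.proj p) := by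
  obtain ⟨v, rfl⟩ := linQuot_surjective p
  rw [linFun_linQuot, proj_linQuot, proj_linQuot, linBaseMap_quot]

theorem triv_linBaseMap (φ : F ⟶ G) (e : F.atlas) (e' : G.atlas) {b : F.baseCoords.mfd}
    (hb : F.baseCoords.proj b ∈ e.1.baseSet)
    (hb' : φ.baseMap (F.baseCoords.proj b) ∈ e'.1.baseSet) :
    (G.baseCoords.triv e' (linBaseMap φ b)).2
      = baseRep φ e.1 e'.1 (F.baseCoords.proj b) (F.baseCoords.triv e b).2 := by
  obtain ⟨v, rfl⟩ := F.baseCoords.quot_surjective b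
  rw [linBaseMap_quot, triv_baseQuot e' ((Vertical.proj_map φ v).symm ▸ hb'), triv_baseQuot e hb]
  exact (baseRep_coord φ e.2 e'.2 v hb hb').symm

theorem triv_linFun (φ : F ⟶ G) (e : F.atlas) (e' : G.atlas) {p : F.fibreCoords.mfd}
    (hb : F.baseCoords.proj (F.fibreCoords.proj p) ∈ e.1.baseSet)
    (hb' : φ.baseMap (F.baseCoords.proj (F.fibreCoords.proj p)) ∈ e'.1.baseSet) :
    (G.fibreCoords.triv e' (linFun φ p)).2
      = fibreRep φ e.1 e'.1 (F.baseCoords.proj (F.fibreCoords.proj p))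
        (F.baseCoords.triv e (F.fibreCoords.proj p)).2 (F.fibreCoords.triv e p).2 := by
  obtain ⟨v, rfl⟩ := linQuot_surjective p
  rw [linFun_linQuot, triv_linQuot e' ((Vertical.proj_map φ v).symm ▸ hb'), triv_linQuot e hb,
    proj_linQuot, triv_baseQuot e hb]
  exact (fibreRep_coord φ e.2 e'.2 v hb hb').symm

/-- In trivialisations the map is `baseRep`, which is smooth as a fibre derivative of the smooth
representative of `φ`. -/
theorem linBaseMap_smooth (φ : F ⟶ G) : SmoothMfd.Smooth (linBaseMap φ) := by
  intro b
  obtain ⟨e, he, hb⟩ := F.atlas_cover (F.baseCoords.proj b)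
  obtain ⟨e', he', hb'⟩ := G.atlas_cover (φ.baseMap (F.baseCoords.proj b))
  have hp := F.baseCoords.proj_smooth
  have hs : IsOpen (F.baseCoords.proj ⁻¹' (e.baseSet ∩ φ.baseMap ⁻¹' e'.baseSet)) :=
    (e.open_baseSet.inter (e'.open_baseSet.preimage φ.base_smooth.continuous)).preimage
      hp.continuous
  refine ContMDiffOn.contMDiffAt (s := F.baseCoords.proj ⁻¹' (e.baseSet ∩ φ.baseMap ⁻¹' e'.baseSet))
    ?_ (hs.mem_nhds ⟨hb, hb'⟩)
  refine (G.baseCoords.triv_smooth ⟨e', he'⟩).contMDiffOn_of_comp (fun b hb => ?_) ?_ ?_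
  · rw [proj_linBaseMap]
    exact hb.2
  · simp only [proj_linBaseMap]
    exact (ContMDiff.comp φ.base_smooth hp).contMDiffOn
  · refine (contMDiffOn_baseRep φ he he' hs (fun b hb => hb) hp.contMDiffOn
      ((F.baseCoords.triv_smooth ⟨e, he⟩).contMDiffOn_snd.mono fun b hb =>
        (F.baseCoords.triv ⟨e, he⟩).mem_source.2 hb.1)).congr fun b hb => ?_
    exact triv_linBaseMap φ ⟨e, he⟩ ⟨e', he'⟩ hb.1 hb.2

theorem linFun_smooth (φ : F ⟶ G) : SmoothMfd.Smooth (linFun φ) := by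
  intro p
  obtain ⟨e, he, hb⟩ := F.atlas_cover (F.baseCoords.proj (F.fibreCoords.proj p))
  obtain ⟨e', he', hb'⟩ := G.atlas_cover (φ.baseMap (F.baseCoords.proj (F.fibreCoords.proj p)))
  have hp := F.fibreCoords.proj_smooth
  have hpp := ContMDiff.comp F.baseCoords.proj_smooth hp
  have hs : IsOpen (F.fibreCoords.proj ⁻¹'
      (F.baseCoords.proj ⁻¹' (e.baseSet ∩ φ.baseMap ⁻¹' e'.baseSet))) :=
    (e.open_baseSet.inter (e'.open_baseSet.preimage φ.base_smooth.continuous)).preimage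
      hpp.continuous
  refine ContMDiffOn.contMDiffAt (s := F.fibreCoords.proj ⁻¹'
      (F.baseCoords.proj ⁻¹' (e.baseSet ∩ φ.baseMap ⁻¹' e'.baseSet))) ?_ (hs.mem_nhds ⟨hb, hb'⟩)
  refine (G.fibreCoords.triv_smooth ⟨e', he'⟩).contMDiffOn_of_comp (fun z hz => ?_) ?_ ?_
  · rw [proj_linFun]
    exact mem_of_eq_of_mem (s := e'.baseSet) (proj_linBaseMap φ (F.fibreCoords.proj z)) hz.2
  · simp only [proj_linFun]
    exact (ContMDiff.comp (linBaseMap_smooth φ) hp).contMDiffOn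
  · refine (contMDiffOn_fibreRep φ he he' hs (fun b hb => hb) hpp.contMDiffOn
      ((F.baseCoords.triv_smooth ⟨e, he⟩).contMDiffOn_snd.comp hp.contMDiffOn fun b hb =>
        (F.baseCoords.triv ⟨e, he⟩).mem_source.2 hb.1)
      ((F.fibreCoords.triv_smooth ⟨e, he⟩).contMDiffOn_snd.mono fun b hb =>
        (F.fibreCoords.triv ⟨e, he⟩).mem_source.2 hb.1)).congr fun b hb => ?_
    exact triv_linFun φ ⟨e, he⟩ ⟨e', he'⟩ hb.1 hb.2

/-- The linearisation of a morphism, as a morphism of filtered bundles. -/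
noncomputable def linFilMap (φ : F ⟶ G) : Hom F.linFil G.linFil where
  toFun := linFun φ
  baseMap := linBaseMap φ
  smooth := linFun_smooth φ
  base_smooth := linBaseMap_smooth φ
  proj_comm := proj_linFun φ
  filtered := by
    rintro _ ⟨e, rfl⟩ _ ⟨e', rfl⟩ b hb hb' i
    have hb'' : φ.baseMap (F.baseCoords.proj b) ∈ e'.1.baseSet := proj_linBaseMap φ b ▸ hb'
    obtain ⟨P, hP, h⟩ := isFilteredPoly (k := k) F.weight_pos
      (φ.filtered e.1 e.2 e'.1 e'.2 (F.baseCoords.proj b) hb hb'') (F.baseCoords.triv e b).2 i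
    refine ⟨P, hP, fun Y => Eq.trans ?_ (h Y)⟩
    obtain ⟨v, rfl, rfl⟩ := F.fibreCoords.exists_coord e b hb Y
    refine (congrArg (fun p => (G.fibreCoords.triv e' (linFun φ p)).2 i)
      (F.fibreCoords.triv_symm hb)).trans ?_
    refine (congrFun (triv_linFun φ e e' (p := F.linQuot v) hb hb'') i).trans ?_
    rw [triv_linQuot e hb]
    rfl

/-! ### The linear structure of the linearisation -/

/-- The action of the reals on the base of the linearisation. -/
noncomputable def baseDil (t : ℝ) (b : F.baseCoords.mfd) : F.baseCoords.mfd :=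
  F.baseCoords.quot (t • Function.surjInv F.baseCoords.quot_surjective b)

/-- The action of the reals on the linearisation. -/
noncomputable def linDil (t : ℝ) (p : F.fibreCoords.mfd) : F.fibreCoords.mfd :=
  F.linQuot (t • Function.surjInv linQuot_surjective p)

theorem baseQuot_smul_congr (t : ℝ) {v v' : F.Vertical}
    (h : F.baseCoords.quot v' = F.baseCoords.quot v) :
    F.baseCoords.quot (t • v') = F.baseCoords.quot (t • v) := by
  obtain ⟨e, he, hv⟩ := F.atlas_cover (F.proj v.pt)
  obtain ⟨h1, h2⟩ := (baseQuot_eq_iff ⟨e, he⟩ hv).1 h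
  refine (baseQuot_eq_iff (v := t • v) (v' := t • v') ⟨e, he⟩ hv).2 ⟨h1, ?_⟩
  rw [Vertical.smul_δX, Vertical.smul_δX]
  exact congrArg (t • ·) h2

theorem linQuot_smul_congr (t : ℝ) {v v' : F.Vertical} (h : F.linQuot v' = F.linQuot v) :
    F.linQuot (t • v') = F.linQuot (t • v) := by
  obtain ⟨e, he, hv⟩ := F.atlas_cover (F.proj v.pt)
  obtain ⟨h1, h2⟩ := (linQuot_eq_iff ⟨e, he⟩ hv).1 h
  refine (linQuot_eq_iff (v := t • v) (v' := t • v') ⟨e, he⟩ hv).2 ⟨baseQuot_smul_congr t h1, ?_⟩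
  rw [Vertical.smul_δX, Vertical.smul_δX, Vertical.smul_X, Vertical.smul_X, fibreCoord_smul,
    fibreCoord_smul]
  exact congrArg (scale t) h2

theorem baseDil_quot (t : ℝ) (v : F.Vertical) :
    baseDil t (F.baseCoords.quot v) = F.baseCoords.quot (t • v) :=
  baseQuot_smul_congr t (Function.surjInv_eq _ _)

theorem linDil_linQuot (t : ℝ) (v : F.Vertical) :
    linDil t (F.linQuot v) = F.linQuot (t • v) :=
  linQuot_smul_congr t (Function.surjInv_eq _ _)

theorem proj_baseDil (t : ℝ) (b : F.baseCoords.mfd) :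
    F.baseCoords.proj (baseDil t b) = F.baseCoords.proj b := by
  obtain ⟨v, rfl⟩ := F.baseCoords.quot_surjective b
  rw [baseDil_quot]
  rfl

theorem proj_linDil (t : ℝ) (p : F.fibreCoords.mfd) :
    F.fibreCoords.proj (linDil t p) = baseDil t (F.fibreCoords.proj p) := by
  obtain ⟨v, rfl⟩ := linQuot_surjective p
  rw [linDil_linQuot, proj_linQuot, proj_linQuot, baseDil_quot]

theorem triv_baseDil (t : ℝ) (e : F.atlas) {b : F.baseCoords.mfd}
    (hb : F.baseCoords.proj b ∈ e.1.baseSet) :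
    (F.baseCoords.triv e (baseDil t b)).2 = t • (F.baseCoords.triv e b).2 := by
  obtain ⟨v, rfl⟩ := F.baseCoords.quot_surjective b
  rw [baseDil_quot, triv_baseQuot e hb, triv_baseQuot e (v := t • v) hb, Vertical.smul_δX]
  rfl

theorem triv_linDil (t : ℝ) (e : F.atlas) {p : F.fibreCoords.mfd}
    (hb : F.baseCoords.proj (F.fibreCoords.proj p) ∈ e.1.baseSet) :
    (F.fibreCoords.triv e (linDil t p)).2 = scale t (F.fibreCoords.triv e p).2 := by
  obtain ⟨v, rfl⟩ := linQuot_surjective p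
  rw [linDil_linQuot, triv_linQuot e hb, triv_linQuot e (v := t • v) hb, Vertical.smul_δX,
    Vertical.smul_X, fibreCoord_smul]

theorem baseDil_smooth :
    ContMDiff (𝓘(ℝ, ℝ).prod 𝓘(ℝ, F.baseCoords.mfd.Model)) 𝓘(ℝ, F.baseCoords.mfd.Model) ∞
      (fun z : ℝ × F.baseCoords.mfd => baseDil z.1 z.2) := by
  rintro ⟨t, b⟩
  obtain ⟨e, he, hb⟩ := F.atlas_cover (F.baseCoords.proj b)
  have hp := F.baseCoords.proj_smooth
  have hs : IsOpen ((univ : Set ℝ) ×ˢ (F.baseCoords.proj ⁻¹' e.baseSet)) :=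
    isOpen_univ.prod (e.open_baseSet.preimage hp.continuous)
  refine ContMDiffOn.contMDiffAt (s := univ ×ˢ (F.baseCoords.proj ⁻¹' e.baseSet))
    ?_ (hs.mem_nhds ⟨trivial, hb⟩)
  refine (F.baseCoords.triv_smooth ⟨e, he⟩).contMDiffOn_of_comp (fun z hz => ?_) ?_ ?_
  · rw [proj_baseDil]
    exact hz.2
  · simp only [proj_baseDil]
    exact (ContMDiff.comp hp contMDiff_snd).contMDiffOn
  · refine (contMDiffOn_fst.smul
      ((F.baseCoords.triv_smooth ⟨e, he⟩).contMDiffOn_snd.comp contMDiffOn_snd fun z hz =>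
        (F.baseCoords.triv ⟨e, he⟩).mem_source.2 hz.2)).congr fun z hz => ?_
    exact triv_baseDil z.1 ⟨e, he⟩ hz.2

theorem linDil_smooth :
    ContMDiff (𝓘(ℝ, ℝ).prod 𝓘(ℝ, F.fibreCoords.mfd.Model)) 𝓘(ℝ, F.fibreCoords.mfd.Model) ∞
      (fun z : ℝ × F.fibreCoords.mfd => linDil z.1 z.2) := by
  rintro ⟨t, p⟩
  obtain ⟨e, he, hb⟩ := F.atlas_cover (F.baseCoords.proj (F.fibreCoords.proj p))
  have hp := F.fibreCoords.proj_smooth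
  have hpp := ContMDiff.comp F.baseCoords.proj_smooth hp
  have hs : IsOpen ((univ : Set ℝ) ×ˢ
      (F.fibreCoords.proj ⁻¹' (F.baseCoords.proj ⁻¹' e.baseSet))) :=
    isOpen_univ.prod (e.open_baseSet.preimage hpp.continuous)
  refine ContMDiffOn.contMDiffAt
    (s := univ ×ˢ (F.fibreCoords.proj ⁻¹' (F.baseCoords.proj ⁻¹' e.baseSet)))
    ?_ (hs.mem_nhds ⟨trivial, hb⟩)
  refine (F.fibreCoords.triv_smooth ⟨e, he⟩).contMDiffOn_of_comp (fun z hz => ?_) ?_ ?_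
  · rw [proj_linDil]
    exact mem_of_eq_of_mem (s := e.baseSet) (proj_baseDil z.1 (F.fibreCoords.proj z.2)) hz.2
  · simp only [proj_linDil]
    exact (ContMDiff.comp baseDil_smooth
      (contMDiff_fst.prodMk (ContMDiff.comp hp contMDiff_snd))).contMDiffOn
  · refine (contDiff_scale.contMDiff.comp_contMDiffOn (contMDiffOn_fst.prodMk_space
      ((F.fibreCoords.triv_smooth ⟨e, he⟩).contMDiffOn_snd.comp contMDiffOn_snd fun z hz =>
        (F.fibreCoords.triv ⟨e, he⟩).mem_source.2 hz.2))).congr fun z hz => ?_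
    exact triv_linDil z.1 ⟨e, he⟩ hz.2

theorem baseDil_smooth_right (t : ℝ) :
    SmoothMfd.Smooth (baseDil t : F.baseCoords.mfd → F.baseCoords.mfd) :=
  ContMDiff.comp (I' := 𝓘(ℝ, ℝ).prod 𝓘(ℝ, F.baseCoords.mfd.Model))
    (f := fun b : F.baseCoords.mfd => (t, b)) baseDil_smooth
    (contMDiff_const.prodMk contMDiff_id)

theorem linDil_smooth_right (t : ℝ) :
    SmoothMfd.Smooth (linDil t : F.fibreCoords.mfd → F.fibreCoords.mfd) :=
  ContMDiff.comp (I' := 𝓘(ℝ, ℝ).prod 𝓘(ℝ, F.fibreCoords.mfd.Model))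
    (f := fun b : F.fibreCoords.mfd => (t, b)) linDil_smooth
    (contMDiff_const.prodMk contMDiff_id)

variable (F) in
/-- The action of a real number, as a morphism of filtered bundles. -/
noncomputable def linDilMap (t : ℝ) : Hom F.linFil F.linFil where
  toFun := linDil t
  baseMap := baseDil t
  smooth := linDil_smooth_right t
  base_smooth := baseDil_smooth_right t
  proj_comm := proj_linDil t
  filtered := by
    rintro _ ⟨e, rfl⟩ _ ⟨e', rfl⟩ b hb hb' i
    -- The action moves `b` only over a fixed point of `F.base`, so `e'` is available at `b` too. In
    -- coordinates the action is then the change from `e` to `e'` followed by `scale t`.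
    have hb2 : F.baseCoords.proj b ∈ e'.1.baseSet := proj_baseDil t b ▸ hb'
    obtain ⟨P, hP, h⟩ := (isFilteredPoly_scale (k := k) (w := F.weight) t i).comp
      (F.linFil.atlas_compatible _ ⟨e, rfl⟩ _ ⟨e', rfl⟩ b hb hb2)
    refine ⟨P, hP, fun Y => Eq.trans ?_ (h Y)⟩
    obtain ⟨v, rfl, rfl⟩ := F.fibreCoords.exists_coord e b hb Y
    refine congrFun (triv_linDil t e' ?_) i
    exact (congrArg (fun p => F.baseCoords.proj (F.fibreCoords.proj p) ∈ e'.1.baseSet)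
      (F.fibreCoords.triv_symm hb)).mpr hb2

end FilteredBundle

/-! ### Regularity of the action -/

namespace SmoothMfd

/-- If a curve in a manifold has velocity zero at `0`, and a function takes the value `t * c` at the
time `t`, then `c = 0`. -/
theorem eq_zero_of_mfderiv_eq_zero {M : SmoothMfd.{u}} {γ : ℝ → M} {f : M → ℝ}
    {c : ℝ} (h : mfderiv 𝓘(ℝ, ℝ) 𝓘(ℝ, M.Model) γ 0 = 0)
    (hγ : MDifferentiableAt 𝓘(ℝ, ℝ) 𝓘(ℝ, M.Model) γ 0)
    (hf : MDifferentiableAt 𝓘(ℝ, M.Model) 𝓘(ℝ, ℝ) f (γ 0)) (hc : ∀ t, f (γ t) = t * c) :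
    c = 0 := by
  have h1 := mfderiv_comp (0 : ℝ) hf hγ
  rw [h, mfderiv_eq_fderiv, show f ∘ γ = fun t => t * c from funext hc] at h1
  have h2 := congrArg (fun A : ℝ →L[ℝ] ℝ => A 1) h1
  have h3 : HasDerivAt (fun t : ℝ => t * c) (1 * c) 0 := (hasDerivAt_id (0 : ℝ)).mul_const c
  have h4 : 1 * c = 0 := h3.deriv.symm.trans (h2.trans
    (mfderiv 𝓘(ℝ, M.Model) 𝓘(ℝ, ℝ) f (γ 0)).map_zero)
  simpa using h4

end SmoothMfd

namespace FilteredBundle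

variable {k : ℕ} {F G H : FilteredBundle.{u} (k + 1)}

theorem linDil_one (p : F.fibreCoords.mfd) : linDil 1 p = p := by
  obtain ⟨v, rfl⟩ := linQuot_surjective p
  rw [linDil_linQuot, Vertical.one_smul]

theorem linDil_mul (s t : ℝ) (p : F.fibreCoords.mfd) :
    linDil (s * t) p = linDil s (linDil t p) := by
  obtain ⟨v, rfl⟩ := linQuot_surjective p
  rw [linDil_linQuot, linDil_linQuot, linDil_linQuot, Vertical.mul_smul]

/-- Along `t ↦ linDil t p` every `δX` coordinate, on the base or on the fibre, equals `t` times its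
value at `p`. Zero velocity at 0 thus forces them all to vanish, and then multiplication by 0
changes no retained coordinate. -/
theorem linDil_regular (p : F.fibreCoords.mfd)
    (h : mfderiv 𝓘(ℝ, ℝ) 𝓘(ℝ, F.fibreCoords.mfd.Model) (fun t : ℝ => linDil t p) 0 = 0) :
    p = linDil 0 p := by
  obtain ⟨v, rfl⟩ := linQuot_surjective p
  obtain ⟨e, he, hv⟩ := F.atlas_cover (F.proj v.pt)
  have hγ : MDifferentiableAt 𝓘(ℝ, ℝ) 𝓘(ℝ, F.fibreCoords.mfd.Model)
      (fun t : ℝ => linDil t (F.linQuot v)) 0 :=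
    (ContMDiff.comp (I' := 𝓘(ℝ, ℝ).prod 𝓘(ℝ, F.fibreCoords.mfd.Model))
      (f := fun t : ℝ => (t, F.linQuot v)) linDil_smooth
      (contMDiff_id.prodMk contMDiff_const)).mdifferentiable (by simp) 0
  have hs : linDil 0 (F.linQuot v) ∈ (F.fibreCoords.triv ⟨e, he⟩).source := by
    rw [linDil_linQuot]
    exact (F.fibreCoords.triv ⟨e, he⟩).mem_source.2 hv
  have hb : F.fibreCoords.proj (linDil 0 (F.linQuot v)) ∈ (F.baseCoords.triv ⟨e, he⟩).source := by
    rw [linDil_linQuot]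
    exact (F.baseCoords.triv ⟨e, he⟩).mem_source.2 hv
  have h1 : ∀ i, 1 < F.weight i → v.δX e i = 0 := fun i hi => by
    refine SmoothMfd.eq_zero_of_mfderiv_eq_zero
      (f := fun p => (F.fibreCoords.triv ⟨e, he⟩ p).2 (.inr ⟨i, hi⟩)) h hγ ?_ fun t => ?_
    · exact (contMDiffAt_pi_space.1 ((F.fibreCoords.triv_smooth ⟨e, he⟩).contMDiffOn_snd.contMDiffAt
        ((F.fibreCoords.triv ⟨e, he⟩).open_source.mem_nhds hs)) _).mdifferentiableAt (by simp)
    · rw [triv_linDil t ⟨e, he⟩ (p := F.linQuot v) hv, triv_linQuot ⟨e, he⟩ hv]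
      rfl
  have h2 : ∀ i, F.weight i = 1 → v.δX e i = 0 := fun i hi => by
    refine SmoothMfd.eq_zero_of_mfderiv_eq_zero
      (f := fun p => (F.baseCoords.triv ⟨e, he⟩ (F.fibreCoords.proj p)).2 ⟨i, hi⟩) h hγ ?_
      fun t => ?_
    · exact ((contMDiffAt_pi_space.1
        ((F.baseCoords.triv_smooth ⟨e, he⟩).contMDiffOn_snd.contMDiffAt
        ((F.baseCoords.triv ⟨e, he⟩).open_source.mem_nhds hb)) _).comp _
        F.fibreCoords.proj_smooth.contMDiffAt).mdifferentiableAt (by simp)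
    · rw [proj_linDil, proj_linQuot, triv_baseDil t ⟨e, he⟩ (b := F.baseCoords.quot v) hv,
        triv_baseQuot ⟨e, he⟩ hv]
      rfl
  have h0 : v.δX e = 0 := funext fun i =>
    (F.weight_pos i).lt_or_eq.elim (h1 i) fun hi => h2 i hi.symm
  rw [linDil_linQuot]
  refine (linQuot_eq_iff (v := (0 : ℝ) • v) ⟨e, he⟩ hv).2
    ⟨(baseQuot_eq_iff (v := (0 : ℝ) • v) ⟨e, he⟩ hv).2 ⟨rfl, ?_⟩, ?_⟩
  · rw [Vertical.smul_δX, h0, smul_zero]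
  · rw [Vertical.smul_δX, Vertical.smul_X, h0, smul_zero]

/-! ### The functor and its universal property -/

variable (F) in
/-- The linearisation as a filtered-linear bundle. -/
noncomputable def linObj : FilteredLinearBundle.{u} k where
  fil := F.linFil
  dil := linDil
  dil_smooth := linDil_smooth
  dil_one := linDil_one
  dil_mul := linDil_mul
  dil_regular := linDil_regular
  dil_filtered t := ⟨F.linDilMap t, rfl⟩

/-- The linearisation of a morphism. -/
noncomputable def linMap (φ : F ⟶ G) : F.linObj ⟶ G.linObj where
  fil := linFilMap φ
  map_dil t p := by
    obtain ⟨v, rfl⟩ := linQuot_surjective p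
    change linFun φ (linDil t (F.linQuot v)) = linDil t (linFun φ (F.linQuot v))
    rw [linDil_linQuot, linFun_linQuot, linFun_linQuot, linDil_linQuot, Vertical.map_smul]

/-- A morphism between linearisations is determined by its composition with the projection from the
vertical bundle. -/
theorem linObj_hom_ext {ψ ψ' : F.linObj ⟶ G.linObj}
    (h : ∀ v, ψ.fil.toFun (F.linQuot v) = ψ'.fil.toFun (F.linQuot v)) : ψ = ψ' := by
  refine FilteredLinearBundle.Hom.ext (Hom.ext (funext fun p => ?_) (funext fun b => ?_))
  · obtain ⟨v, rfl⟩ := linQuot_surjective p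
    exact h v
  -- Points of the base lift to vertical vectors as well, so the map of total spaces determines the
  -- base map.
  · obtain ⟨v, rfl⟩ := F.baseCoords.quot_surjective b
    exact (ψ.fil.proj_comm (F.linQuot v)).symm.trans
      ((congrArg G.linFil.proj (h v)).trans (ψ'.fil.proj_comm (F.linQuot v)))

/-- The linearisation functor. -/
noncomputable def linFunctor (k : ℕ) :
    FilteredBundle.{u} (k + 1) ⥤ FilteredLinearBundle.{u} k where
  obj := linObj
  map := linMap
  -- Tested on vertical vectors, the functor laws become those of the vertical tangent map.
  map_id F := linObj_hom_ext fun v =>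
    (linFun_linQuot (𝟙 F) v).trans (congrArg F.linQuot (Vertical.map_id v))
  map_comp {_ _ H} φ ψ := linObj_hom_ext fun v =>
    (linFun_linQuot (φ ≫ ψ) v).trans ((congrArg H.linQuot (Vertical.map_comp φ ψ v)).trans
      ((linFun_linQuot ψ _).symm.trans (congrArg (linFun ψ) (linFun_linQuot φ v).symm)))

theorem isLinearisation_linObj (F : FilteredBundle.{u} (k + 1)) :
    IsLinearisation F F.linObj F.linQuot where
  map_smul t v := (linDil_linQuot t v).symm
  coordinates := by
    refine ⟨F.baseCoords.proj, Equiv.refl _, F.baseCoords.proj_smooth, fun _ => rfl, fun _ => rfl,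
      fun _ => rfl, fun e he => ⟨F.baseCoords.triv ⟨e, he⟩, F.baseCoords.triv_smooth ⟨e, he⟩, rfl,
      F.fibreCoords.triv ⟨e, he⟩, ⟨_, rfl⟩, rfl, fun v hv => ⟨fun i => ?_, fun i => ?_,
      fun i => ?_⟩⟩⟩
    · exact congrArg (fun z => z.2 i) (triv_baseQuot ⟨e, he⟩ hv)
    · exact congrArg (fun z => z.2 (.inl i)) (triv_linQuot ⟨e, he⟩ hv)
    · exact congrArg (fun z => z.2 (.inr i)) (triv_linQuot ⟨e, he⟩ hv)

end FilteredBundle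

/-- The equivalence combines existence (`linFun_linQuot`) with uniqueness (`linObj_hom_ext`).
Writing the degree as `k + 1` encodes that it is at least 1. -/
theorem mainTheorem6 (k : ℕ) :
    ∃ (Linr : FilteredBundle.{u} (k + 1) ⥤ FilteredLinearBundle.{u} k)
      (q : ∀ F : FilteredBundle.{u} (k + 1), F.Vertical → (Linr.obj F).fil.total),
      (∀ F : FilteredBundle.{u} (k + 1), FilteredBundle.IsLinearisation F (Linr.obj F) (q F)) ∧
      ∀ (F G : FilteredBundle.{u} (k + 1)) (φ : F ⟶ G) (ψ : Linr.obj F ⟶ Linr.obj G),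
        ψ = Linr.map φ ↔
          ∀ v : F.Vertical, ψ.fil.toFun (q F v) = q G (FilteredBundle.Vertical.map φ v) := by
  refine ⟨FilteredBundle.linFunctor k, FilteredBundle.linQuot,
    FilteredBundle.isLinearisation_linObj, fun F G φ ψ => ⟨?_, fun h => ?_⟩⟩
  · rintro rfl v
    exact FilteredBundle.linFun_linQuot φ v
  · exact FilteredBundle.linObj_hom_ext fun v =>
      (h v).trans (FilteredBundle.linFun_linQuot φ v).symm
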